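/- Let $\mathcal R_q$ be Harman and Hopkins' ring of quantum integer-valued polynomials: for a formal variable $q$, it consists of the polynomials $f(x)\in\mathbb{Q}(q)[x]$ with $f([n]_q)\in\mathbb{Z}[q,q^{-1}]$ for all $n\in\mathbb{Z}$, where $[n]_q=\frac{q^n-1}{q-1}$. Let $\mathbb{F}$ be a finite field with $|\mathbb{F}|=q_0$. For $f\in\mathcal R_q$ and $n\in\mathbb Z$, write $f([n]_q)|_{q=q_0}\in\mathbb{Z}[q_0^{-1}]\subset\mathbb{Q}$ for the value of the Laurent polynomial $f([n]_q)$ at $q=q_0$. Let $\Phi$ be the set of monic irreducible polynomials in $\mathbb{F}[t]$ other than $t$. A multipartition is a function $\boldsymbol\mu$ from $\Phi$ to the set of partitions that is the empty partition at all but finitely many elements of $\Phi$. The type of $g\in GL_m(\mathbb{F})$ is the multipartition $\boldsymbol\mu$ such that, for all $r\in\Phi$ and $i\ge 1$, the number of parts of $\boldsymbol\mu(r)$ equal to $i$ is the multiplicity of $r(t)^i$ as an elementary divisor of the $\mathbb{F}[t]$-module $\mathbb{F}^m$ on which $t$ acts by $g$. The modified type of $g$ is obtained from its type $\boldsymbol\mu$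 by subtracting $1$ from every part of $\boldsymbol\mu(t-1)$ (and discarding the parts that become $0$), leaving $\boldsymbol\mu(r)$ unchanged for $r\neq t-1$. For a multipartition $\boldsymbol\nu$ and an integer $m\ge 0$, let $X_{\boldsymbol\nu,m}\in Z(\mathbb{Z}GL_m(\mathbb{F}))$ be the sum of all elements of $GL_m(\mathbb{F})$ of modified type $\boldsymbol\nu$ (so $X_{\boldsymbol\nu,m}=0$ if there are none). **Theorem.** There are elements $r_{\boldsymbol\mu,\boldsymbol\nu}^{\boldsymbol\lambda}\in\mathcal R_q$, indexed by triples of multipartitions $\boldsymbol\mu,\boldsymbol\nu,\boldsymbol\lambda$, with only finitely many nonzero for each fixed $\boldsymbol\mu,\boldsymbol\nu$, such that for all integers $m\ge 0$ and all multipartitions $\boldsymbol\mu,\boldsymbol\nu$, $$X_{\boldsymbol\mu,m}\,X_{\boldsymbol\nu,m}=\sum_{\boldsymbol\lambda} r_{\boldsymbol\mu,\boldsymbol\nu}^{\boldsymbol\lambda}([m]_q)\big|_{q=q_0}\;X_{\boldsymbol\lambda,m}.$$ Here $r_{\boldsymbol\mu,\boldsymbol\nu}^{\boldsymbol\lambda}([m]_q)|_{q=q_0}$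 is an integer whenever $X_{\boldsymbol\lambda,m}\neq 0$, so that this is an identity in $Z(\mathbb{Z}GL_m(\mathbb{F}))$. Moreover, these coefficients are polynomial in $q_0^m$: for all $\boldsymbol\mu,\boldsymbol\nu,\boldsymbol\lambda$ there is a polynomial $P\in\mathbb{Q}[t]$ with $r_{\boldsymbol\mu,\boldsymbol\nu}^{\boldsymbol\lambda}([m]_q)|_{q=q_0}=P(q_0^m)$ for all $m\in\mathbb{Z}$. -/

import Mathlib

open Polynomial DirectSum

noncomputable section

namespace StableCentre

/-! ### Quantum integer-valued polynomials -/

/-- The `q`-integer `[n]_q = (q ^ n - 1) / (q - 1)`, for `n : ℤ`, in the field `ℚ(q)` of rational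
functions in a formal variable `q`. -/
def qInt (n : ℤ) : RatFunc ℚ := (RatFunc.X ^ n - 1) / (RatFunc.X - 1)

/-- The ring `ℤ[q, q⁻¹]` of Laurent polynomials, as a subring of `ℚ(q)`. -/
def laurent : Subring (RatFunc ℚ) := Subring.closure {RatFunc.X, RatFunc.X⁻¹}

/-- The ring `R_q` of quantum integer-valued polynomials of Harman and Hopkins: the polynomials
`f(x)` with coefficients in `ℚ(q)` such that `f([n]_q)` lies in `ℤ[q, q⁻¹]` for all integers `n`. -/
def quantumIntValued : Subring (RatFunc ℚ)[X] where
  carrier := {f | ∀ n : ℤ, f.eval (qInt n) ∈ laurent}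
  mul_mem' hf hg n := by
    rw [eval_mul]; exact laurent.mul_mem (hf n) (hg n)
  one_mem' n := by
    rw [eval_one]; exact laurent.one_mem
  add_mem' hf hg n := by
    rw [eval_add]; exact laurent.add_mem (hf n) (hg n)
  zero_mem' n := by
    rw [eval_zero]; exact laurent.zero_mem
  neg_mem' hf n := by
    rw [eval_neg]; exact laurent.neg_mem (hf n)

/-- The value `f([n]_q)` of `f ∈ R_q`, where the formal variable `q` is specialised to the nonzero
number `q₀`. As `f([n]_q)` lies in `ℤ[q, q⁻¹]`, its denominator is a power of `q`, so that the
evaluation at `q₀ ≠ 0` is the usual one. -/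
def valueAt (q₀ : ℕ) (f : quantumIntValued) (n : ℤ) : ℚ :=
  RatFunc.eval (RingHom.id ℚ) (q₀ : ℚ) ((f : (RatFunc ℚ)[X]).eval (qInt n))

/-! ### Partitions, multipartitions, types -/

/-- Partitions, as finite multisets of positive integers (the nonzero parts). -/
abbrev Ptn : Type := Multiset ℕ+

/-- Monic irreducible polynomials over `F` different from `t`. -/
def Phi (F : Type*) [Field F] : Type _ := {r : F[X] // r.Monic ∧ Irreducible r ∧ r ≠ X}

/-- The polynomial `t - 1`, as an element of `Phi F`. -/
def tSubOne (F : Type*) [Field F] : Phi F :=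
  ⟨X - C 1, monic_X_sub_C 1, irreducible_X_sub_C 1, fun h => by
    have := congrArg (Polynomial.eval (0 : F)) h
    simp at this⟩

/-- Multipartitions: functions from `Phi F` to partitions whose value is the empty partition at all
but finitely many elements. -/
abbrev MultiPtn (F : Type*) [Field F] : Type _ := Phi F →₀ Ptn

/-- Subtract `1` from each part of a partition and forget the parts that become `0` (delete the
first column of the Young diagram). -/
def deleteColumn (s : Ptn) : Ptn :=
  s.filterMap fun p => if h : 0 < (p : ℕ) - 1 then some ⟨(p : ℕ) - 1, h⟩ else none

open Classical in
/-- The modified multipartition: delete the first column of the partition at `t - 1`, and keep the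
partitions at all other polynomials. -/
def removeColumnAtOne {F : Type*} [Field F] (μ : MultiPtn F) : MultiPtn F :=
  μ.update (tSubOne F) (deleteColumn (μ (tSubOne F)))

/-- `g ∈ GL_m(F)` has type `μ`: the `F[t]`-module `F ^ m`, on which `t` acts by `g`, is a direct sum
of modules `F[t] / (r ^ i)` with `r` in `Phi F` and `i ≥ 1`, in which the pair `(r, i)` occurs
exactly as often as `i` occurs as a part of `μ(r)`; that is, the elementary divisors of the module
are the powers `r ^ i` with these multiplicities. -/
def HasType {F : Type*} [Field F] {m : ℕ} (g : GL (Fin m) F) (μ : MultiPtn F) : Prop :=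
  ∃ (k : ℕ) (p : Fin k → Phi F) (e : Fin k → ℕ+),
    (∀ (r : Phi F) (i : ℕ+), Multiset.count i (μ r) = Nat.card {j : Fin k // p j = r ∧ e j = i}) ∧
    Nonempty (Module.AEval' (Matrix.toLin' (g : Matrix (Fin m) (Fin m) F)) ≃ₗ[F[X]]
      ⨁ j : Fin k, F[X] ⧸ Ideal.span {(p j).1 ^ (e j : ℕ)})

/-- `g ∈ GL_m(F)` has modified type `ν`. -/
def HasModifiedType {F : Type*} [Field F] {m : ℕ} (g : GL (Fin m) F) (ν : MultiPtn F) : Prop :=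
  ∃ μ : MultiPtn F, HasType g μ ∧ removeColumnAtOne μ = ν

/-! ### The sums `X_{ν,m}` -/

/-- Conjugate matrices have the same type. -/
theorem HasType.conj {F : Type*} [Field F] {m : ℕ} {g : GL (Fin m) F} {μ : MultiPtn F}
    (h : HasType g μ) (x : GL (Fin m) F) : HasType (x * g * x⁻¹) μ := by
  obtain ⟨k, p, e, hc, ⟨φ⟩⟩ := h
  let f : (Fin m → F) ≃ₗ[F] (Fin m → F) :=
    LinearEquiv.ofLinearMap (Matrix.toLin' (x⁻¹ : GL (Fin m) F).1) (Matrix.toLin' x.1)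
      (by rw [← Matrix.toLin'_mul, ← Units.val_mul]; simp)
      (by rw [← Matrix.toLin'_mul, ← Units.val_mul]; simp)
  have ψ : Module.AEval' (Matrix.toLin' (x * g * x⁻¹).1) ≃ₗ[F[X]]
      Module.AEval' (Matrix.toLin' g.1) := by
    refine LinearEquiv.ofAEval _ (f.trans (Module.AEval'.of (Matrix.toLin' g.1))) fun v => ?_
    rw [LinearEquiv.trans_apply, LinearEquiv.trans_apply, Module.AEval'.X_smul_of]
    congr 1
    simp only [f, LinearEquiv.coe_ofLinearMap, Matrix.toLin'_apply, Matrix.mulVec_mulVec,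
      Module.End.smul_def, ← Units.val_mul]
    congr 2
    group
  exact ⟨k, p, e, hc, ⟨ψ.trans φ⟩⟩

theorem hasModifiedType_conj_iff {F : Type*} [Field F] {m : ℕ} (g x : GL (Fin m) F)
    (ν : MultiPtn F) : HasModifiedType (x * g * x⁻¹) ν ↔ HasModifiedType g ν := by
  constructor
  · rintro ⟨μ, h, rfl⟩
    have h' := h.conj x⁻¹
    have e : x⁻¹ * (x * g * x⁻¹) * x⁻¹⁻¹ = g := by group
    rw [e] at h'
    exact ⟨μ, h', rfl⟩
  · rintro ⟨μ, h, rfl⟩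
    exact ⟨μ, h.conj x, rfl⟩

open Classical in
/-- The sum of all elements of `GL_m(F)` of modified type `ν`, in the group ring `ℤ GL_m(F)`. -/
def modifiedTypeSum {F : Type*} [Field F] [Fintype F] (ν : MultiPtn F) (m : ℕ) :
    MonoidAlgebra ℤ (GL (Fin m) F) :=
  ∑ g : GL (Fin m) F with HasModifiedType g ν, MonoidAlgebra.of ℤ (GL (Fin m) F) g

theorem modifiedTypeSum_mem_center {F : Type*} [Field F] [Fintype F] (ν : MultiPtn F) (m : ℕ) :
    modifiedTypeSum ν m ∈ Subring.center (MonoidAlgebra ℤ (GL (Fin m) F)) := by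
  classical
  have key (x : GL (Fin m) F) : MonoidAlgebra.of ℤ _ x * modifiedTypeSum ν m =
      modifiedTypeSum ν m * MonoidAlgebra.of ℤ _ x := by
    simp only [modifiedTypeSum, Finset.mul_sum, Finset.sum_mul, ← map_mul]
    refine Finset.sum_bij' (fun g _ => x * g * x⁻¹) (fun g _ => x⁻¹ * g * x) ?_ ?_ ?_ ?_ ?_
    · intro g hg
      simpa [hasModifiedType_conj_iff] using hg
    · intro g hg
      have := hasModifiedType_conj_iff g x⁻¹ ν
      rw [inv_inv] at this
      simpa [this] using hg
    · intro g _; group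
    · intro g _; group
    · intro g _; congr 1; group
  rw [Subring.mem_center_iff]
  intro a
  induction a using MonoidAlgebra.induction_on with
  | of x => exact key x
  | add a b ha hb => rw [add_mul, mul_add, ha, hb]
  | smul n a ha => rw [smul_mul_assoc, mul_smul_comm, ha]

/-- The sum `X_{ν,m}` of all elements of modified type `ν`, in the centre `Z(ℤ GL_m(F))`. -/
def XSum {F : Type*} [Field F] [Fintype F] (ν : MultiPtn F) (m : ℕ) :
    Subring.center (MonoidAlgebra ℤ (GL (Fin m) F)) :=
  ⟨modifiedTypeSum ν m, modifiedTypeSum_mem_center ν m⟩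

/-- The inclusion of `Z(ℤ GL_m(F))` into the group algebra `ℚ GL_m(F)`. -/
def toRat {F : Type*} [Field F] {m : ℕ} :
    Subring.center (MonoidAlgebra ℤ (GL (Fin m) F)) →+* MonoidAlgebra ℚ (GL (Fin m) F) :=
  (MonoidAlgebra.mapRingHom (GL (Fin m) F) (Int.castRingHom ℚ)).comp (Subring.subtype _)

end StableCentre

end

noncomputable section

namespace StableCentre

/-! Write q for the order of the field. The modified type of `a` is the isomorphism class of the
`F[t]`-module (t - 1)M, where M is the space V with t acting as `a`: multiplication by t - 1
shortens each (t - 1)-primary cyclic summand by one and is bijective on the other primary summands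
(`HasElemDiv.reduced`). The coefficient of g in the product of two class sums is the number
`pairCount` of factorisations g = ab with a and b of the given modified types. It must be shown
that, for g of modified type λ, this number depends only on m and is polynomial in q^m.

Since (t - 1)M and dim M determine M, every g of modified type λ is conjugate to g₀ ⊕ id on V₀ ×
F^s, where g₀ is one such element of smallest possible size m₀ and m = m₀ + s
(`exists_intertwining_of_endModType`).

The modified type of a fixes the rank i of a - 1. Write a - 1 = uv with u injective and v
surjective, through E₁ = F^i. There are |GL(E₁)| such factorisations, and the modified type of 1 +
uv is the type of 1 + vu (`endModType_one_add_comp_iff`), a condition on the fixed space E₁.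
Treating b in the same way with E₂ replaces pairs (a, b) by pairs of linear maps U : E₁ × E₂ → V and
W : V → E₁ × E₂, up to a constant factor. Split V as V₀ × F^s, with components A of U and B of W at
F^s. All the conditions see A and B only through ker A, range B and BA
(`isGoodQuad_iff_isGoodData`), which take values in a finite set independent of s. For fixed values
of these the number of pairs (A, B) is polynomial in q^s, by linear algebra and Möbius inversion
over subspaces (`natCard_ker_eq_range_eq_mem_expPoly`).

A polynomial in q^s with integer values at all natural s is an integral combination of Gaussian
binomials [s choose k] (`exists_gaussian_expansion`). Replacing these by the formal binomials [x -
m₀ choose k] gives an element of the ring of quantum integer-valued polynomials. Finally, rank(ab -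
1) ≤ rank(a - 1) + rank(b - 1), so only finitely many λ occur for given μ and ν
(`finite_setOf_pairCount_ne_zero`). -/

/-! ### Gaussian binomial coefficients -/

/-- The Gaussian binomial coefficient `[n choose k]_q`, for an integer `n`. -/
def gaussian {K : Type*} [Field K] (q : K) (k : ℕ) (n : ℤ) : K :=
  ∏ i ∈ Finset.range k, (q ^ (n - i) - 1) / (q ^ (i + 1) - 1)

/-- The polynomial in `q ^ n` whose value is the Gaussian binomial `[n - d choose k]_q`. -/
def gaussianPoly {K : Type*} [Field K] (q : K) (d : ℤ) (k : ℕ) : K[X] :=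
  ∏ i ∈ Finset.range k, (C (q ^ (-(d + i))) * X - C 1) * C (q ^ (i + 1) - 1)⁻¹

section Gaussian

variable {K : Type*} [Field K] {q : K}

@[simp]
theorem gaussian_zero (n : ℤ) : gaussian q 0 n = 1 := by
  simp [gaussian]

theorem gaussian_succ (k : ℕ) (n : ℤ) :
    gaussian q (k + 1) n = gaussian q k n * ((q ^ (n - k) - 1) / (q ^ (k + 1) - 1)) :=
  Finset.prod_range_succ _ _

theorem gaussian_succ_succ (k : ℕ) (n : ℤ) :
    gaussian q (k + 1) (n + 1) = gaussian q k n * ((q ^ (n + 1) - 1) / (q ^ (k + 1) - 1)) := by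
  have h (i : ℕ) : n + 1 - ((i + 1 : ℕ) : ℤ) = n - i := by push_cast; ring
  unfold gaussian
  rw [Finset.prod_div_distrib, Finset.prod_div_distrib, Finset.prod_range_succ',
    Finset.prod_range_succ (fun i => q ^ (i + 1) - 1)]
  simp only [h, Nat.cast_zero, sub_zero]
  rw [mul_div_mul_comm]

/-- Both terms with lower index k + 1 are multiples of `gaussian q k n`, so the claim reduces to
q^(n+1) - 1 = q^(k+1) (q^(n-k) - 1) + (q^(k+1) - 1), valid for negative n too. -/
theorem gaussian_pascal (hq : q ≠ 0) (hq1 : ∀ i : ℕ, q ^ (i + 1) ≠ 1) (k : ℕ) (n : ℤ) :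
    gaussian q (k + 1) (n + 1) = q ^ (k + 1) * gaussian q (k + 1) n + gaussian q k n := by
  rw [gaussian_succ_succ, gaussian_succ]
  have h : q ^ (k + 1) - 1 ≠ 0 := sub_ne_zero.2 (hq1 k)
  have h2 : q ^ (n + 1) = q ^ (k + 1) * q ^ (n - k) := by
    rw [← zpow_natCast, ← zpow_add₀ hq]; congr 1; push_cast; ring
  rw [h2]
  field_simp
  ring

theorem gaussian_self (hq1 : ∀ i : ℕ, q ^ (i + 1) ≠ 1) (k : ℕ) : gaussian q k k = 1 := by
  induction k with
  | zero => simp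
  | succ k ih =>
    have h : q ^ (k + 1) - 1 ≠ 0 := sub_ne_zero.2 (hq1 k)
    have h' : q ^ ((k : ℤ) + 1) = q ^ (k + 1) := by
      rw [← zpow_natCast]; push_cast; rfl
    rw [Nat.cast_succ, gaussian_succ_succ, ih, h', div_self h, one_mul]

theorem gaussian_eq_zero {k n : ℕ} (h : n < k) : gaussian q k n = 0 :=
  Finset.prod_eq_zero (Finset.mem_range.2 h) (by simp)

theorem gaussian_natCast_mem (hq : q ≠ 0) (hq1 : ∀ i : ℕ, q ^ (i + 1) ≠ 1) (S : Subring K)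
    (hS : q ∈ S) (k n : ℕ) : gaussian q k n ∈ S := by
  induction n generalizing k with
  | zero =>
    cases k with
    | zero => simp
    | succ k => rw [gaussian_eq_zero (Nat.succ_pos k)]; exact S.zero_mem
  | succ n ih =>
    cases k with
    | zero => simp
    | succ k =>
      rw [Nat.cast_succ, gaussian_pascal hq hq1]
      exact S.add_mem (S.mul_mem (S.pow_mem hS _) (ih _)) (ih _)

/-- Pascal's rule is run in both directions from n = 0; solving it for the smaller argument divides
by a power of q, hence the need for q⁻¹. -/
theorem gaussian_mem (hq : q ≠ 0) (hq1 : ∀ i : ℕ, q ^ (i + 1) ≠ 1) (S : Subring K)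
    (hS : q ∈ S) (hS' : q⁻¹ ∈ S) (k : ℕ) (n : ℤ) : gaussian q k n ∈ S := by
  induction k generalizing n with
  | zero => simp
  | succ k ih =>
    induction n using Int.induction_on with
    | zero =>
      have := gaussian_eq_zero (q := q) (Nat.succ_pos k)
      rw [Nat.cast_zero] at this
      rw [this]; exact S.zero_mem
    | succ n h =>
      rw [gaussian_pascal hq hq1]
      exact S.add_mem (S.mul_mem (S.pow_mem hS _) h) (ih _)
    | pred n h =>
      have := gaussian_pascal hq hq1 k (-(n : ℤ) - 1)
      rw [sub_add_cancel] at this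
      have h2 : gaussian q (k + 1) (-(n : ℤ) - 1) =
          q⁻¹ ^ (k + 1) * (gaussian q (k + 1) (-n) - gaussian q k (-(n : ℤ) - 1)) := by
        rw [this, add_sub_cancel_right, ← mul_assoc, ← mul_pow, inv_mul_cancel₀ hq, one_pow,
          one_mul]
      rw [h2]
      exact S.mul_mem (S.pow_mem hS' _) (S.sub_mem h (ih _))

theorem gaussianPoly_eval (hq : q ≠ 0) (d : ℤ) (k : ℕ) (n : ℤ) :
    (gaussianPoly q d k).eval (q ^ n) = gaussian q k (n - d) := by
  simp only [gaussianPoly, gaussian, eval_prod]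
  refine Finset.prod_congr rfl fun i _ => ?_
  rw [eval_mul, eval_sub, eval_mul, eval_C, eval_C, eval_X, eval_C, ← zpow_add₀ hq, div_eq_mul_inv]
  congr 3
  ring_nf

theorem gaussianPoly_natDegree_le (d : ℤ) (k : ℕ) : (gaussianPoly q d k).natDegree ≤ k := by
  refine (natDegree_prod_le _ _).trans ?_
  refine (Finset.sum_le_card_nsmul _ _ 1 fun i _ => ?_).trans (by simp)
  refine (natDegree_mul_C_le _ _).trans ((natDegree_sub_le _ _).trans ?_)
  simp only [natDegree_C, zero_le, sup_of_le_left]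
  exact (natDegree_C_mul_le _ _).trans natDegree_X_le

end Gaussian

/-- A polynomial in `q ^ s` which takes integer values for all `s : ℕ` is an integral combination
of Gaussian binomial coefficients. -/
theorem exists_gaussian_expansion {q : ℚ} (hq : q ≠ 0) (hq1 : ∀ i : ℕ, q ^ (i + 1) ≠ 1)
    (hqZ : q ∈ (Int.castRingHom ℚ).range) (c : ℕ → ℤ) (P : ℚ[X])
    (hP : ∀ s : ℕ, (c s : ℚ) = P.eval (q ^ s)) :
    ∃ (N : ℕ) (a : ℕ → ℤ), ∀ s : ℕ, (c s : ℚ) = ∑ k ∈ Finset.range N, a k * gaussian q k s := by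
  have key (n : ℕ) : ∃ a : ℕ → ℤ, ∀ s < n,
      (c s : ℚ) = ∑ k ∈ Finset.range n, a k * gaussian q k s := by
    induction n with
    | zero => exact ⟨0, by simp⟩
    | succ n ih =>
      obtain ⟨a, ha⟩ := ih
      have hmem : (c n : ℚ) - ∑ k ∈ Finset.range n, a k * gaussian q k n ∈
          (Int.castRingHom ℚ).range :=
        Subring.sub_mem _ ⟨c n, rfl⟩ (Subring.sum_mem _ fun k _ =>
          Subring.mul_mem _ ⟨a k, rfl⟩ (gaussian_natCast_mem hq hq1 _ hqZ k n))
      -- Newton interpolation: [s choose n] is 0 for s < n and 1 for s = n, so the next coefficient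
      -- is the integer error at s = n.
      obtain ⟨z, hz⟩ := hmem
      have hsum (s : ℕ) : ∑ k ∈ Finset.range n, (Function.update a n z k : ℚ) * gaussian q k s =
          ∑ k ∈ Finset.range n, (a k : ℚ) * gaussian q k s :=
        Finset.sum_congr rfl fun k hk => by
          rw [Function.update_of_ne (Finset.mem_range.1 hk).ne]
      refine ⟨Function.update a n z, fun s hs => ?_⟩
      rw [Finset.sum_range_succ, hsum, Function.update_self]
      rcases Nat.lt_succ_iff_lt_or_eq.1 hs with h | rfl
      · rw [gaussian_eq_zero h, mul_zero, add_zero, ha s h]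
      · rw [gaussian_self hq1, mul_one]
        simp only [eq_intCast] at hz
        rw [hz]; ring
  -- Agreement at deg P + 1 points suffices: both sides have degree at most deg P in q^s, and the
  -- nodes q^s are distinct because q is not a root of unity.
  obtain ⟨a, ha⟩ := key (P.natDegree + 1)
  refine ⟨P.natDegree + 1, a, ?_⟩
  have hinj : Set.InjOn (fun s : ℕ => q ^ s) (Finset.range (P.natDegree + 1)) := by
    have : ∀ s t : ℕ, s < t → q ^ s ≠ q ^ t := fun s t hst h => by
      obtain ⟨d, rfl⟩ := Nat.exists_eq_add_of_lt hst
      rw [add_assoc, pow_add] at h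
      exact hq1 d (mul_left_cancel₀ (pow_ne_zero s hq) (by rw [← h, mul_one]))
    intro s _ t _ h
    rcases lt_trichotomy s t with h' | h' | h'
    · exact (this s t h' h).elim
    · exact h'
    · exact (this t s h' h.symm).elim
  have heval (s : ℕ) : (∑ k ∈ Finset.range (P.natDegree + 1), C (a k : ℚ) * gaussianPoly q 0 k).eval
      (q ^ s) = ∑ k ∈ Finset.range (P.natDegree + 1), a k * gaussian q k s := by
    rw [eval_finsetSum]
    refine Finset.sum_congr rfl fun k _ => ?_
    have := gaussianPoly_eval hq 0 k s
    rw [zpow_natCast, sub_zero] at this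
    rw [eval_mul, eval_C, this]
  have hPeq : P = ∑ k ∈ Finset.range (P.natDegree + 1), C (a k : ℚ) * gaussianPoly q 0 k := by
    refine eq_of_degrees_lt_of_eval_index_eq (Finset.range (P.natDegree + 1)) hinj ?_ ?_ ?_
    · rw [Finset.card_range]
      exact degree_le_natDegree.trans_lt (by exact_mod_cast Nat.lt_succ_self _)
    · rw [Finset.card_range]
      refine (degree_sum_le _ _).trans_lt ?_
      rw [Finset.sup_lt_iff (WithBot.bot_lt_coe _)]
      intro k hk
      refine (degree_le_natDegree).trans_lt ?_
      have := (natDegree_C_mul_le (a k : ℚ) (gaussianPoly q 0 k)).trans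
        (gaussianPoly_natDegree_le 0 k)
      exact_mod_cast this.trans_lt (Finset.mem_range.1 hk)
    · intro s hs
      rw [heval, ← hP, ha s (Finset.mem_range.1 hs)]
  intro s
  rw [hP, ← heval, ← hPeq]

/-! ### Specialising the formal variable -/

/-- Denominators of sums and products divide the product of the denominators. This is what makes
`RatFunc.eval` at q₀ additive and multiplicative on `laurent`. -/
theorem laurent_denom_eval_ne_zero {q₀ : ℚ} (h : q₀ ≠ 0) {x : RatFunc ℚ} (hx : x ∈ laurent) :
    eval₂ (RingHom.id ℚ) q₀ x.denom ≠ 0 := by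
  have hdvd {f g : ℚ[X]} (hfg : f ∣ g) (hg : eval₂ (RingHom.id ℚ) q₀ g ≠ 0) :
      eval₂ (RingHom.id ℚ) q₀ f ≠ 0 := by
    obtain ⟨k, rfl⟩ := hfg
    rw [eval₂_mul] at hg
    exact left_ne_zero_of_mul hg
  induction hx using Subring.closure_induction with
  | mem x hx =>
    rcases hx with rfl | rfl
    · simp
    · refine hdvd (RatFunc.denom_inv_dvd RatFunc.X_ne_zero) ?_
      simpa using h
  | zero => simp
  | one => simp
  | add x y _ _ hx hy =>
    refine hdvd (RatFunc.denom_add_dvd x y) ?_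
    rw [eval₂_mul]
    exact mul_ne_zero hx hy
  | neg x _ hx =>
    have : -x = RatFunc.C (-1) * x := by simp
    rw [this]
    refine hdvd (RatFunc.denom_mul_dvd _ x) ?_
    rw [eval₂_mul, RatFunc.denom_C]
    simpa using hx
  | mul x y _ _ hx hy =>
    refine hdvd (RatFunc.denom_mul_dvd x y) ?_
    rw [eval₂_mul]
    exact mul_ne_zero hx hy

/-- The specialisation of Laurent polynomials at `q = q₀`. -/
def laurentEval (q₀ : ℚ) (h : q₀ ≠ 0) : laurent →+* ℚ where
  toFun x := RatFunc.eval (RingHom.id ℚ) q₀ x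
  map_one' := by simp
  map_zero' := by simp
  map_mul' x y := by
    rw [Subring.coe_mul]
    exact RatFunc.eval_mul _ _ (laurent_denom_eval_ne_zero h x.2) (laurent_denom_eval_ne_zero h y.2)
  map_add' x y := by
    rw [Subring.coe_add]
    exact RatFunc.eval_add _ _ (laurent_denom_eval_ne_zero h x.2) (laurent_denom_eval_ne_zero h y.2)

theorem X_mem_laurent : RatFunc.X ∈ laurent := Subring.subset_closure (by simp)

theorem X_inv_mem_laurent : RatFunc.X⁻¹ ∈ laurent := Subring.subset_closure (by simp)

theorem X_zpow_mem_laurent (n : ℤ) : RatFunc.X ^ n ∈ laurent := by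
  obtain ⟨k, rfl | rfl⟩ := n.eq_nat_or_neg
  · rw [zpow_natCast]; exact laurent.pow_mem X_mem_laurent k
  · rw [zpow_neg, zpow_natCast, ← inv_pow]; exact laurent.pow_mem X_inv_mem_laurent k

theorem laurentEval_X_zpow {q₀ : ℚ} (h : q₀ ≠ 0) (n : ℤ) :
    laurentEval q₀ h ⟨RatFunc.X ^ n, X_zpow_mem_laurent n⟩ = q₀ ^ n := by
  have h1 : laurentEval q₀ h ⟨RatFunc.X, X_mem_laurent⟩ = q₀ := by simp [laurentEval]
  have hp (k : ℕ) : laurentEval q₀ h ⟨RatFunc.X ^ (k : ℤ), X_zpow_mem_laurent k⟩ = q₀ ^ k := by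
    have : (⟨RatFunc.X ^ (k : ℤ), X_zpow_mem_laurent k⟩ : laurent) =
        ⟨RatFunc.X, X_mem_laurent⟩ ^ k := Subtype.ext (by simp)
    rw [this, map_pow, h1]
  obtain ⟨k, rfl | rfl⟩ := n.eq_nat_or_neg
  · rw [hp, zpow_natCast]
  · have hm : (⟨RatFunc.X ^ (-(k : ℤ)), X_zpow_mem_laurent _⟩ : laurent) *
        ⟨RatFunc.X ^ (k : ℤ), X_zpow_mem_laurent k⟩ = 1 := Subtype.ext (by
      simp only [Subring.coe_mul, Subring.coe_one]
      rw [← zpow_add₀ RatFunc.X_ne_zero]; simp)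
    have := congrArg (laurentEval q₀ h) hm
    rw [map_mul, hp, map_one] at this
    rw [eq_inv_of_mul_eq_one_left this, zpow_neg, zpow_natCast]

theorem X_pow_ne_one (i : ℕ) : (RatFunc.X : RatFunc ℚ) ^ (i + 1) ≠ 1 := by
  intro h
  rw [← RatFunc.algebraMap_X, ← map_pow, ← map_one (algebraMap ℚ[X] (RatFunc ℚ))] at h
  have := congrArg natDegree (RatFunc.algebraMap_injective ℚ h)
  simp at this

theorem gaussian_mem_laurent (k : ℕ) (n : ℤ) : gaussian RatFunc.X k n ∈ laurent :=
  gaussian_mem RatFunc.X_ne_zero X_pow_ne_one _ X_mem_laurent X_inv_mem_laurent k n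

/-- The single factors of a Gaussian binomial need not be Laurent polynomials, so the recursion in k
is specialised with denominators cleared, and then divided by q₀^(k+1) - 1. -/
theorem laurentEval_gaussian {q₀ : ℚ} (h : q₀ ≠ 0) (h1 : ∀ i : ℕ, q₀ ^ (i + 1) ≠ 1) (k : ℕ)
    (n : ℤ) : laurentEval q₀ h ⟨gaussian RatFunc.X k n, gaussian_mem_laurent k n⟩ =
      gaussian q₀ k n := by
  induction k with
  | zero =>
    have : (⟨gaussian RatFunc.X 0 n, gaussian_mem_laurent 0 n⟩ : laurent) = 1 :=
      Subtype.ext (by simp)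
    rw [this, map_one, gaussian_zero]
  | succ k ih =>
    have hm : (⟨gaussian RatFunc.X (k + 1) n, gaussian_mem_laurent (k + 1) n⟩ : laurent) *
        (⟨RatFunc.X ^ ((k + 1 : ℕ) : ℤ), X_zpow_mem_laurent _⟩ - 1) =
        ⟨gaussian RatFunc.X k n, gaussian_mem_laurent k n⟩ *
          (⟨RatFunc.X ^ (n - k), X_zpow_mem_laurent _⟩ - 1) := Subtype.ext (by
      have := sub_ne_zero.2 (X_pow_ne_one k)
      simp only [Subring.coe_mul, AddSubgroupClass.coe_sub, Subring.coe_one, zpow_natCast]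
      rw [gaussian_succ]
      field_simp)
    have := congrArg (laurentEval q₀ h) hm
    rw [map_mul, map_mul, map_sub, map_sub, map_one, ih, laurentEval_X_zpow, laurentEval_X_zpow,
      zpow_natCast] at this
    refine Eq.trans ?_ (gaussian_succ k n).symm
    rw [mul_div_assoc', eq_div_iff (sub_ne_zero.2 (h1 k)), this]

/-- The quantum integer-valued polynomial `[x - d choose k]_q`. -/
def quantumBinomial (d : ℤ) (k : ℕ) : quantumIntValued :=
  ⟨(gaussianPoly RatFunc.X d k).comp (C (RatFunc.X - 1) * X + C 1), fun n => by
    have hX : (RatFunc.X : RatFunc ℚ) - 1 ≠ 0 := by simpa using sub_ne_zero.2 (X_pow_ne_one 0)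
    -- The substitution x ↦ (q - 1)x + 1 turns [n]_q into q^n.
    have : (RatFunc.X - 1) * qInt n + 1 = (RatFunc.X : RatFunc ℚ) ^ n := by
      rw [qInt, mul_div_cancel₀ _ hX, sub_add_cancel]
    rw [eval_comp, eval_add, eval_mul, eval_C, eval_X, eval_C, this,
      gaussianPoly_eval RatFunc.X_ne_zero]
    exact gaussian_mem_laurent _ _⟩

theorem quantumBinomial_eval (d : ℤ) (k : ℕ) (n : ℤ) :
    (quantumBinomial d k : (RatFunc ℚ)[X]).eval (qInt n) = gaussian RatFunc.X k (n - d) := by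
  have hX : (RatFunc.X : RatFunc ℚ) - 1 ≠ 0 := by simpa using sub_ne_zero.2 (X_pow_ne_one 0)
  have : (RatFunc.X - 1) * qInt n + 1 = (RatFunc.X : RatFunc ℚ) ^ n := by
    rw [qInt, mul_div_cancel₀ _ hX, sub_add_cancel]
  rw [quantumBinomial, eval_comp, eval_add, eval_mul, eval_C, eval_X, eval_C, this,
    gaussianPoly_eval RatFunc.X_ne_zero]

/-- The specialised value at `[n]_q`, as a ring homomorphism. -/
def valueHom (q₀ : ℕ) (h : (q₀ : ℚ) ≠ 0) (n : ℤ) : quantumIntValued →+* ℚ :=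
  (laurentEval q₀ h).comp
    (((evalRingHom (qInt n)).comp quantumIntValued.subtype).codRestrict laurent fun f => f.2 n)

theorem valueHom_apply (q₀ : ℕ) (h : (q₀ : ℚ) ≠ 0) (n : ℤ) (f : quantumIntValued) :
    valueHom q₀ h n f = valueAt q₀ f n := rfl

theorem valueAt_quantumBinomial {q₀ : ℕ} (h : 1 < q₀) (d : ℤ) (k : ℕ) (n : ℤ) :
    valueAt q₀ (quantumBinomial d k) n = gaussian (q₀ : ℚ) k (n - d) := by
  have h0 : (q₀ : ℚ) ≠ 0 := by positivity
  have h1 (i : ℕ) : (q₀ : ℚ) ^ (i + 1) ≠ 1 :=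
    (one_lt_pow₀ (by exact_mod_cast h) (Nat.succ_ne_zero i)).ne'
  rw [valueAt, quantumBinomial_eval, ← laurentEval_gaussian h0 h1]
  rfl

/-- A polynomial in `q₀ ^ s` with integer values is, after a shift of the argument, given by
an element of the ring of quantum integer-valued polynomials. -/
theorem exists_quantumIntValued {q₀ : ℕ} (h : 1 < q₀) (d : ℤ) (c : ℕ → ℤ) (P : ℚ[X])
    (hP : ∀ s : ℕ, (c s : ℚ) = P.eval ((q₀ : ℚ) ^ s)) :
    ∃ f : quantumIntValued, (∀ s : ℕ, valueAt q₀ f (d + s) = c s) ∧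
      ∃ Q : ℚ[X], ∀ n : ℤ, valueAt q₀ f n = Q.eval ((q₀ : ℚ) ^ n) := by
  have h0 : (q₀ : ℚ) ≠ 0 := by positivity
  have h1 (i : ℕ) : (q₀ : ℚ) ^ (i + 1) ≠ 1 :=
    (one_lt_pow₀ (by exact_mod_cast h) (Nat.succ_ne_zero i)).ne'
  obtain ⟨N, a, ha⟩ := exists_gaussian_expansion h0 h1 ⟨q₀, by simp⟩ c P hP
  have hval (n : ℤ) : valueAt q₀ (∑ k ∈ Finset.range N, (a k : quantumIntValued) *
      quantumBinomial d k) n = ∑ k ∈ Finset.range N, a k * gaussian (q₀ : ℚ) k (n - d) := by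
    rw [← valueHom_apply q₀ h0, map_sum]
    refine Finset.sum_congr rfl fun k _ => ?_
    rw [map_mul, map_intCast, valueHom_apply, valueAt_quantumBinomial h]
  -- The expansion of c with its binomials shifted by d, so that n = d + s gives back [s choose k].
  refine ⟨∑ k ∈ Finset.range N, (a k : quantumIntValued) * quantumBinomial d k, fun s => ?_,
    ∑ k ∈ Finset.range N, C (a k : ℚ) * gaussianPoly (q₀ : ℚ) d k, fun n => ?_⟩
  · rw [hval, ha]
    simp
  · rw [hval, eval_finsetSum]
    refine Finset.sum_congr rfl fun k _ => ?_
    rw [eval_mul, eval_C, gaussianPoly_eval h0]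

/-! ### Multiples of a module -/

/-- The submodule `a M` of a module `M`. -/
def smulRange {R : Type*} [CommRing R] (a : R) (M : Type*) [AddCommGroup M] [Module R M] :
    Submodule R M := LinearMap.range (LinearMap.lsmul R M a)

theorem mem_smulRange {R : Type*} [CommRing R] {a : R} {M : Type*} [AddCommGroup M] [Module R M]
    {x : M} : x ∈ smulRange a M ↔ ∃ y : M, a • y = x := by
  simp [smulRange]

/-- Isomorphic modules have isomorphic multiples. -/
def smulRangeEquiv {R : Type*} [CommRing R] (a : R) {M M' : Type*} [AddCommGroup M] [Module R M]
    [AddCommGroup M'] [Module R M'] (f : M ≃ₗ[R] M') : smulRange a M ≃ₗ[R] smulRange a M' :=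
  f.ofSubmodules _ _ (by
    ext x
    simp only [Submodule.mem_map, mem_smulRange]
    constructor
    · rintro ⟨_, ⟨y, rfl⟩, rfl⟩
      exact ⟨f y, by simp⟩
    · rintro ⟨y, rfl⟩
      exact ⟨a • f.symm y, ⟨_, rfl⟩, by simp⟩)

/-! ### Products of primary cyclic modules -/

section Primary

variable {F : Type*} [Field F]

/-- The product of the `F[t]`-modules `F[t] / (p_j ^ e_j)`; some `e_j` may be `0`. -/
abbrev PrimaryProd {ι : Type*} (p : ι → Phi F) (e : ι → ℕ) : Type _ :=
  (j : ι) → F[X] ⧸ Ideal.span {(p j).1 ^ e j}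

open Classical in
/-- Lower the exponents at the polynomial `r` by `i`. -/
def lowerAt {ι : Type*} (r : Phi F) (i : ℕ) (p : ι → Phi F) (e : ι → ℕ) (j : ι) : ℕ :=
  if p j = r then e j - i else e j

/-- The multiplicity of `(r, i)`. -/
def mult {ι : Type*} (p : ι → Phi F) (e : ι → ℕ) (r : Phi F) (i : ℕ) : ℕ :=
  Nat.card {j // p j = r ∧ e j = i}

/-- The number of exponents at `r` that are greater than `i`. -/
def tail {ι : Type*} (p : ι → Phi F) (e : ι → ℕ) (r : Phi F) (i : ℕ) : ℕ :=
  Nat.card {j // p j = r ∧ i < e j}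

theorem Phi.isCoprime {p r : Phi F} (h : p ≠ r) : IsCoprime p.1 r.1 := by
  rw [Irreducible.coprime_iff_not_dvd p.2.2.1]
  intro hd
  have := (p.2.2.1.dvd_irreducible_iff_associated r.2.2.1).1 hd
  exact h (Subtype.ext (eq_of_monic_of_associated p.2.1 r.2.1 this))

/-- r^i is a unit modulo p^e if p ≠ r, and otherwise cancels i factors; truncated subtraction covers
i > e. The two directions make multiplication by r^i from F[t]/(p^e') to F[t]/(p^e) injective and
well defined. -/
theorem Phi.pow_dvd_mul_iff {p r : Phi F} {e i e' : ℕ} (h : p ≠ r ∧ e' = e ∨ p = r ∧ e' = e - i)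
    (f : F[X]) : p.1 ^ e ∣ r.1 ^ i * f ↔ p.1 ^ e' ∣ f := by
  rcases h with ⟨h, rfl⟩ | ⟨rfl, rfl⟩
  · exact ⟨fun hd => ((Phi.isCoprime h).pow).dvd_of_dvd_mul_left hd, fun hd => hd.mul_left _⟩
  · rcases le_total i e with hi | hi
    · obtain ⟨k, rfl⟩ := Nat.exists_eq_add_of_le hi
      rw [pow_add, Nat.add_sub_cancel_left]
      exact mul_dvd_mul_iff_left (pow_ne_zero _ p.2.2.1.ne_zero)
    · rw [Nat.sub_eq_zero_of_le hi, pow_zero]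
      exact ⟨fun _ => one_dvd _, fun _ => (pow_dvd_pow _ hi).mul_right _⟩

variable {ι ι' : Type*}

theorem lowerAt_spec (r : Phi F) (i : ℕ) (p : ι → Phi F) (e : ι → ℕ) (j : ι) :
    p j ≠ r ∧ lowerAt r i p e j = e j ∨ p j = r ∧ lowerAt r i p e j = e j - i := by
  unfold lowerAt
  split_ifs with h
  · exact .inr ⟨h, rfl⟩
  · exact .inl ⟨h, rfl⟩

/-- The multiples of a product of primary cyclic modules. -/
theorem nonempty_primaryProd_equiv_smulRange (r : Phi F) (i : ℕ) (p : ι → Phi F) (e : ι → ℕ) :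
    Nonempty (PrimaryProd p (lowerAt r i p e) ≃ₗ[F[X]] smulRange (r.1 ^ i) (PrimaryProd p e)) := by
  have hle (j : ι) : Ideal.span {(p j).1 ^ lowerAt r i p e j} ≤
      Submodule.comap (LinearMap.lsmul F[X] F[X] (r.1 ^ i)) (Ideal.span {(p j).1 ^ e j}) := by
    intro f hf
    rw [Ideal.mem_span_singleton] at hf
    rw [Submodule.mem_comap, LinearMap.lsmul_apply, smul_eq_mul, Ideal.mem_span_singleton]
    exact (Phi.pow_dvd_mul_iff (lowerAt_spec r i p e j) f).2 hf
  -- Multiplication by r^i, from the quotient with the lowered exponent; it is injective with image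
  -- the r^i-multiples.
  let ψ (j : ι) : (F[X] ⧸ Ideal.span {(p j).1 ^ lowerAt r i p e j}) →ₗ[F[X]]
      F[X] ⧸ Ideal.span {(p j).1 ^ e j} :=
    Submodule.mapQ _ _ (LinearMap.lsmul F[X] F[X] (r.1 ^ i)) (hle j)
  have hmk (j : ι) (f : F[X]) : ψ j (Submodule.Quotient.mk f) =
      r.1 ^ i • (Submodule.Quotient.mk f : F[X] ⧸ Ideal.span {(p j).1 ^ e j}) := by
    rfl
  have hinj (j : ι) : Function.Injective (ψ j) := by
    rw [injective_iff_map_eq_zero]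
    intro x hx
    obtain ⟨f, rfl⟩ := Submodule.Quotient.mk_surjective _ x
    rw [hmk, ← Submodule.Quotient.mk_smul, Submodule.Quotient.mk_eq_zero, smul_eq_mul,
      Ideal.mem_span_singleton, Phi.pow_dvd_mul_iff (lowerAt_spec r i p e j)] at hx
    rw [Submodule.Quotient.mk_eq_zero]
    exact Ideal.mem_span_singleton.2 hx
  let Ψ : PrimaryProd p (lowerAt r i p e) →ₗ[F[X]] PrimaryProd p e :=
    LinearMap.pi fun j => (ψ j).comp (LinearMap.proj j)
  have hΨ : Function.Injective Ψ := fun x y h => funext fun j => hinj j (congrFun h j)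
  have hrange : LinearMap.range Ψ = smulRange (r.1 ^ i) (PrimaryProd p e) := by
    ext x
    rw [mem_smulRange]
    constructor
    · rintro ⟨y, rfl⟩
      choose f hf using fun j => Submodule.Quotient.mk_surjective _ (y j)
      refine ⟨fun j => Submodule.Quotient.mk (f j), funext fun j => ?_⟩
      change _ = ψ j (y j)
      rw [← hf, hmk]
      rfl
    · rintro ⟨y, rfl⟩
      choose f hf using fun j => Submodule.Quotient.mk_surjective _ (y j)
      refine ⟨fun j => Submodule.Quotient.mk (f j), funext fun j => ?_⟩
      change ψ j (Submodule.Quotient.mk (f j)) = r.1 ^ i • y j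
      rw [← hf, hmk]
  exact ⟨(LinearEquiv.ofInjective Ψ hΨ).trans (LinearEquiv.ofEq _ _ hrange)⟩

theorem natCard_primaryProd [Fintype ι] (p : ι → Phi F) (e : ι → ℕ) :
    Nat.card (PrimaryProd p e) = ∏ j, Nat.card F ^ ((p j).1.natDegree * e j) := by
  rw [Nat.card_pi]
  refine Finset.prod_congr rfl fun j _ => ?_
  have := ((p j).2.1.pow (e j)).finite_quotient
  rw [Module.natCard_eq_pow_finrank (K := F), finrank_quotient_span_eq_natDegree, natDegree_pow,
    mul_comm]

/-- Passing from r^(i+1) to r^i enlarges precisely the factors at r with exponent above i, each by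
q^(deg r). The sizes of the multiples of M thus reveal the tails. -/
theorem natCard_smulRange_pow [Finite ι] {M : Type*} [AddCommGroup M] [Module F[X] M]
    {p : ι → Phi F} {e : ι → ℕ} (f : M ≃ₗ[F[X]] PrimaryProd p e) (r : Phi F) (i : ℕ) :
    Nat.card (smulRange (r.1 ^ i) M) = Nat.card (smulRange (r.1 ^ (i + 1)) M) *
      (Nat.card F ^ r.1.natDegree) ^ tail p e r i := by
  classical
  have := Fintype.ofFinite ι
  have h (i : ℕ) : Nat.card (smulRange (r.1 ^ i) M) =
      ∏ j, Nat.card F ^ ((p j).1.natDegree * lowerAt r i p e j) := by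
    obtain ⟨g⟩ := nonempty_primaryProd_equiv_smulRange r i p e
    rw [← natCard_primaryProd]
    exact Nat.card_congr ((smulRangeEquiv _ f).trans g.symm).toEquiv
  have ht : tail p e r i = (Finset.univ.filter fun j => p j = r ∧ i < e j).card := by
    rw [tail, Nat.card_eq_fintype_card, Fintype.card_subtype]
  rw [h, h, ht, ← Finset.prod_const, Finset.prod_filter, ← Finset.prod_mul_distrib]
  refine Finset.prod_congr rfl fun j _ => ?_
  unfold lowerAt
  by_cases hr : p j = r
  · by_cases hi : i < e j
    · rw [if_pos hr, if_pos hr, if_pos ⟨hr, hi⟩, ← hr, ← pow_add, ← Nat.mul_succ]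
      congr 2
      omega
    · rw [if_pos hr, if_pos hr, if_neg (fun h => hi h.2), mul_one]
      congr 2
      omega
  · rw [if_neg hr, if_neg hr, if_neg (fun h => hr h.1), mul_one]

theorem finite_primaryProd [Finite F] [Finite ι] (p : ι → Phi F) (e : ι → ℕ) :
    Finite (PrimaryProd p e) := by
  have (j : ι) : Finite (F[X] ⧸ Ideal.span {(p j).1 ^ e j}) := by
    have := ((p j).2.1.pow (e j)).finite_quotient
    exact Module.finite_of_finite F
  infer_instance

theorem natCard_pow_natDegree_gt_one [Finite F] (r : Phi F) :
    1 < Nat.card F ^ r.1.natDegree :=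
  Nat.one_lt_pow r.2.2.1.natDegree_pos.ne' Finite.one_lt_card

theorem tail_eq_of_card [Finite F] [Finite ι] [Finite ι'] {M M' : Type*} [AddCommGroup M]
    [Module F[X] M] [AddCommGroup M'] [Module F[X] M']
    {p : ι → Phi F} {e : ι → ℕ} {p' : ι' → Phi F} {e' : ι' → ℕ}
    (f : M ≃ₗ[F[X]] PrimaryProd p e) (f' : M' ≃ₗ[F[X]] PrimaryProd p' e') (r : Phi F) (i : ℕ)
    (h : Nat.card (smulRange (r.1 ^ i) M) = Nat.card (smulRange (r.1 ^ i) M'))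
    (h' : Nat.card (smulRange (r.1 ^ (i + 1)) M) = Nat.card (smulRange (r.1 ^ (i + 1)) M')) :
    tail p e r i = tail p' e' r i := by
  have := finite_primaryProd p' e'
  have : Finite M' := Finite.of_equiv _ f'.symm.toEquiv
  rw [natCard_smulRange_pow f, natCard_smulRange_pow f', h'] at h
  exact Nat.pow_right_injective (natCard_pow_natDegree_gt_one r)
    (Nat.eq_of_mul_eq_mul_left Nat.card_pos h)

theorem tail_eq_of_equiv [Finite F] [Finite ι] [Finite ι']
    {p : ι → Phi F} {e : ι → ℕ} {p' : ι' → Phi F} {e' : ι' → ℕ}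
    (f : PrimaryProd p e ≃ₗ[F[X]] PrimaryProd p' e') (r : Phi F) (i : ℕ) :
    tail p e r i = tail p' e' r i :=
  tail_eq_of_card (.refl _ _) (.refl _ _) r i (Nat.card_congr (smulRangeEquiv _ f).toEquiv)
    (Nat.card_congr (smulRangeEquiv _ f).toEquiv)

theorem tail_eq_mult_add_tail [Finite ι] (p : ι → Phi F) (e : ι → ℕ) (r : Phi F) (i : ℕ) :
    tail p e r i = mult p e r (i + 1) + tail p e r (i + 1) := by
  classical
  have := Fintype.ofFinite ι
  simp only [tail, mult, Nat.card_eq_fintype_card, Fintype.card_subtype]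
  rw [← Finset.card_union_of_disjoint]
  · congr 1
    ext j
    simp only [Finset.mem_filter, Finset.mem_union, Finset.mem_univ, true_and, ← and_or_left]
    refine and_congr_right fun _ => ?_
    omega
  · rw [Finset.disjoint_filter]
    intro j _ h1 h2
    omega

/-- Multiplicities are differences of consecutive tails. Exponent 0 is excluded, since trivial
factors leave no trace in the module. -/
theorem mult_eq_of_tail_eq [Finite ι] [Finite ι']
    {p : ι → Phi F} {e : ι → ℕ} {p' : ι' → Phi F} {e' : ι' → ℕ}
    (h : ∀ r i, tail p e r i = tail p' e' r i) (r : Phi F) (i : ℕ) :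
    mult p e r (i + 1) = mult p' e' r (i + 1) := by
  have h1 := tail_eq_mult_add_tail p e r i
  have h2 := tail_eq_mult_add_tail p' e' r i
  rw [h, h, h2] at h1
  exact (Nat.add_right_cancel h1).symm

/-- Trivial factors can be omitted from a product of primary cyclic modules. -/
theorem nonempty_primaryProd_equiv_subtype (p : ι → Phi F) (e : ι → ℕ) :
    Nonempty (PrimaryProd p e ≃ₗ[F[X]]
      PrimaryProd (fun j : {j // e j ≠ 0} => p j) (fun j : {j // e j ≠ 0} => e j)) := by
  classical
  have hsub (j : ι) (hj : ¬ e j ≠ 0) (x : F[X] ⧸ Ideal.span {(p j).1 ^ e j}) : x = 0 := by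
    obtain ⟨f, rfl⟩ := Submodule.Quotient.mk_surjective _ x
    rw [Submodule.Quotient.mk_eq_zero, Ideal.mem_span_singleton, not_not.1 hj, pow_zero]
    exact one_dvd f
  let φ : PrimaryProd p e →ₗ[F[X]]
      PrimaryProd (fun j : {j // e j ≠ 0} => p j) (fun j : {j // e j ≠ 0} => e j) :=
    { toFun := fun x j => x j
      map_add' := fun _ _ => rfl
      map_smul' := fun _ _ => rfl }
  refine ⟨LinearEquiv.ofBijective φ ⟨fun x y h => funext fun j => ?_, fun y => ?_⟩⟩
  · by_cases hj : e j ≠ 0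
    · exact congrFun h ⟨j, hj⟩
    · rw [hsub j hj (x j), hsub j hj (y j)]
  · refine ⟨fun j => if hj : e j ≠ 0 then y ⟨j, hj⟩ else 0, funext fun j => ?_⟩
    exact dif_pos j.2

theorem nonempty_primaryProd_equiv_of_equiv {p : ι → Phi F} {e : ι → ℕ} {p' : ι' → Phi F}
    {e' : ι' → ℕ} (σ : ι ≃ ι') (hp : ∀ j, p' (σ j) = p j) (he : ∀ j, e' (σ j) = e j) :
    Nonempty (PrimaryProd p e ≃ₗ[F[X]] PrimaryProd p' e') :=
  ⟨(LinearEquiv.piCongrRight fun j => Submodule.quotEquivOfEq _ _ (by rw [hp, he])).trans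
    (LinearEquiv.piCongrLeft F[X] (fun j' => F[X] ⧸ Ideal.span {(p' j').1 ^ e' j'}) σ)⟩

/-- The nontrivial factors of a given kind. -/
def fiberEquiv (p : ι → Phi F) (e : ι → ℕ) (c : Phi F × ℕ) :
    {j : {j // e j ≠ 0} // (p j, e j) = c} ≃ {j // c.2 ≠ 0 ∧ p j = c.1 ∧ e j = c.2} where
  toFun j := ⟨j.1.1, by rw [← j.2]; exact j.1.2, congrArg Prod.fst j.2, congrArg Prod.snd j.2⟩
  invFun j := ⟨⟨j.1, by rw [j.2.2.2]; exact j.2.1⟩, Prod.ext j.2.2.1 j.2.2.2⟩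
  left_inv _ := rfl
  right_inv _ := rfl

/-- Products of primary cyclic modules with the same multiplicities are isomorphic. -/
theorem nonempty_primaryProd_equiv [Finite ι] [Finite ι']
    {p : ι → Phi F} {e : ι → ℕ} {p' : ι' → Phi F} {e' : ι' → ℕ}
    (h : ∀ r i, mult p e r (i + 1) = mult p' e' r (i + 1)) :
    Nonempty (PrimaryProd p e ≃ₗ[F[X]] PrimaryProd p' e') := by
  obtain ⟨f⟩ := nonempty_primaryProd_equiv_subtype p e
  obtain ⟨f'⟩ := nonempty_primaryProd_equiv_subtype p' e'
  -- Once trivial factors are dropped, the fibres at exponent 0 are empty, so the hypothesis on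
  -- positive exponents matches all fibres.
  have hfib (c : Phi F × ℕ) : Nonempty ({j : {j // e j ≠ 0} // (p j, e j) = c} ≃
      {j : {j // e' j ≠ 0} // (p' j, e' j) = c}) := by
    have k := fiberEquiv p e c
    have k' := fiberEquiv p' e' c
    obtain ⟨r, i⟩ := c
    cases i with
    | zero =>
      have h1 : IsEmpty {j // (0 : ℕ) ≠ 0 ∧ p j = r ∧ e j = 0} := ⟨fun j => j.2.1 rfl⟩
      have h2 : IsEmpty {j // (0 : ℕ) ≠ 0 ∧ p' j = r ∧ e' j = 0} := ⟨fun j => j.2.1 rfl⟩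
      exact ⟨k.trans ((Equiv.equivOfIsEmpty _ _).trans k'.symm)⟩
    | succ i =>
      obtain ⟨g⟩ := Finite.card_eq.1 (h r i)
      exact ⟨k.trans (((Equiv.subtypeEquivRight fun j => by simp).trans
        (g.trans (Equiv.subtypeEquivRight fun j => by simp))).trans k'.symm)⟩
  let σ := Equiv.ofFiberEquiv (fun c => (hfib c).some)
  have hσ (j : {j // e j ≠ 0}) : (p' (σ j), e' (σ j)) = (p j, e j) :=
    Equiv.ofFiberEquiv_map (fun c => (hfib c).some) j
  obtain ⟨g⟩ := nonempty_primaryProd_equiv_of_equiv (F := F) (p := fun j : {j // e j ≠ 0} => p j)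
    (e := fun j : {j // e j ≠ 0} => e j) (p' := fun j : {j // e' j ≠ 0} => p' j)
    (e' := fun j : {j // e' j ≠ 0} => e' j) σ (fun j => congrArg Prod.fst (hσ j))
    (fun j => congrArg Prod.snd (hσ j))
  exact ⟨f.trans (g.trans f'.symm)⟩

end Primary

/-! ### Elementary divisors of modules -/

section ElemDiv

variable {F : Type*} [Field F]

/-- The elementary divisors of the `F[t]`-module `M` are given by the multipartition `μ`. -/
def HasElemDiv (M : Type*) [AddCommGroup M] [Module F[X] M] (μ : MultiPtn F) : Prop :=
  ∃ (k : ℕ) (p : Fin k → Phi F) (e : Fin k → ℕ+),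
    (∀ (r : Phi F) (i : ℕ+), Multiset.count i (μ r) = Nat.card {j : Fin k // p j = r ∧ e j = i}) ∧
    Nonempty (M ≃ₗ[F[X]] ⨁ j : Fin k, F[X] ⧸ Ideal.span {(p j).1 ^ (e j : ℕ)})

variable {M M' : Type*} [AddCommGroup M] [Module F[X] M] [AddCommGroup M'] [Module F[X] M']

theorem HasElemDiv.congr {μ : MultiPtn F} (h : HasElemDiv M μ) (f : M ≃ₗ[F[X]] M') :
    HasElemDiv M' μ := by
  obtain ⟨k, p, e, hc, ⟨φ⟩⟩ := h
  exact ⟨k, p, e, hc, ⟨f.symm.trans φ⟩⟩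

/-- Natural exponents are used from here on because lowering them may produce 0. -/
theorem HasElemDiv.exists_primaryProd {μ : MultiPtn F} (h : HasElemDiv M μ) :
    ∃ (k : ℕ) (p : Fin k → Phi F) (e : Fin k → ℕ),
      (∀ (r : Phi F) (i : ℕ+), Multiset.count i (μ r) = mult p e r i) ∧
      Nonempty (M ≃ₗ[F[X]] PrimaryProd p e) := by
  obtain ⟨k, p, e, hc, ⟨φ⟩⟩ := h
  refine ⟨k, p, fun j => e j, fun r i => ?_, ⟨φ.trans (DirectSum.linearEquivFunOnFintype _ _ _)⟩⟩
  rw [hc, mult]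
  exact Nat.card_congr (Equiv.subtypeEquivRight fun j => by rw [PNat.coe_inj])

theorem hasElemDiv_of_primaryProd {ι : Type*} [Finite ι] {p : ι → Phi F} {e : ι → ℕ}
    {μ : MultiPtn F} (hc : ∀ (r : Phi F) (i : ℕ+), Multiset.count i (μ r) = mult p e r i)
    (φ : M ≃ₗ[F[X]] PrimaryProd p e) : HasElemDiv M μ := by
  obtain ⟨ψ⟩ := nonempty_primaryProd_equiv_subtype p e
  let σ := Finite.equivFin {j // e j ≠ 0}
  obtain ⟨χ⟩ := nonempty_primaryProd_equiv_of_equiv (p := fun j : {j // e j ≠ 0} => p j)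
    (e := fun j : {j // e j ≠ 0} => e j) (p' := fun j => p (σ.symm j))
    (e' := fun j => e (σ.symm j)) σ (by simp) (by simp)
  refine ⟨_, fun j => p (σ.symm j), fun j => ⟨e (σ.symm j), Nat.pos_of_ne_zero (σ.symm j).2⟩, ?_,
    ⟨(φ.trans (ψ.trans χ)).trans (DirectSum.linearEquivFunOnFintype F[X] _
      fun j => F[X] ⧸ Ideal.span {(p (σ.symm j)).1 ^ e (σ.symm j)}).symm⟩⟩
  intro r i
  rw [hc, mult]
  refine Nat.card_congr ⟨fun j => ⟨σ ⟨j.1, by rw [j.2.2]; exact i.ne_zero⟩, ?_, ?_⟩,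
    fun j => ⟨σ.symm j.1, j.2.1, congrArg PNat.val j.2.2⟩, fun j => ?_, fun j => ?_⟩
  · simpa using j.2.1
  · exact PNat.eq (by simpa using j.2.2)
  · simp
  · simp

/-- A choice of the multipartition of the multiplicities of a family of prime powers. -/
theorem exists_multiPtn {ι : Type*} [Finite ι] (p : ι → Phi F) (e : ι → ℕ) :
    ∃ μ : MultiPtn F, ∀ (r : Phi F) (i : ℕ+), Multiset.count i (μ r) = mult p e r i := by
  classical
  have := Fintype.ofFinite ι
  let s : ι → Ptn := fun j => if h : 0 < e j then {Nat.toPNat (e j) h} else 0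
  refine ⟨∑ j, Finsupp.single (p j) (s j), fun r i => ?_⟩
  rw [Finsupp.finsetSum_apply, Multiset.count_sum', mult, Nat.card_eq_fintype_card,
    Fintype.card_subtype, Finset.card_filter]
  refine Finset.sum_congr rfl fun j _ => ?_
  by_cases hr : p j = r
  · subst hr
    rw [Finsupp.single_eq_same]
    by_cases h : 0 < e j
    · have : s j = {Nat.toPNat (e j) h} := dif_pos h
      rw [this, Multiset.count_singleton]
      refine if_congr ?_ rfl rfl
      rw [← PNat.coe_inj, eq_comm, and_iff_right rfl]
      rfl
    · have : e j ≠ i := fun h' => h (h' ▸ i.pos)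
      simp [s, dif_neg h, this]
  · rw [Finsupp.single_eq_of_ne (Ne.symm hr)]
    simp [hr]

theorem HasElemDiv.nonempty_equiv {μ : MultiPtn F} (h : HasElemDiv M μ) (h' : HasElemDiv M' μ) :
    Nonempty (M ≃ₗ[F[X]] M') := by
  obtain ⟨k, p, e, hc, ⟨φ⟩⟩ := h.exists_primaryProd
  obtain ⟨k', p', e', hc', ⟨φ'⟩⟩ := h'.exists_primaryProd
  obtain ⟨ψ⟩ := nonempty_primaryProd_equiv (p := p) (e := e) (p' := p') (e' := e') fun r i =>
    (hc r i.succPNat).symm.trans (hc' r i.succPNat)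
  exact ⟨φ.trans (ψ.trans φ'.symm)⟩

/-- The elementary divisors are unique. -/
theorem HasElemDiv.unique [Finite F] {μ μ' : MultiPtn F} (h : HasElemDiv M μ)
    (h' : HasElemDiv M μ') : μ = μ' := by
  obtain ⟨k, p, e, hc, ⟨φ⟩⟩ := h.exists_primaryProd
  obtain ⟨k', p', e', hc', ⟨φ'⟩⟩ := h'.exists_primaryProd
  have := mult_eq_of_tail_eq (tail_eq_of_equiv (φ.symm.trans φ'))
  refine Finsupp.ext fun r => Multiset.ext.2 fun i => ?_
  rw [hc, hc']
  have := this r (i.natPred)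
  rwa [PNat.natPred_add_one] at this

/-- The coercion of `s` to a multiset of natural numbers inside `deleteColumn` is a bind of
singletons; this rewrites it as a map. -/
theorem deleteColumn_eq (s : Ptn) : deleteColumn s = (s.map PNat.val).filterMap
    fun n => if h : 0 < n - 1 then some (Nat.toPNat (n - 1) h) else none :=
  congrArg (Multiset.filterMap _) (Multiset.bind_singleton s PNat.val)

theorem count_deleteColumn (s : Ptn) (i : ℕ+) :
    Multiset.count i (deleteColumn s) = Multiset.count (i + 1) s := by
  classical
  rw [deleteColumn_eq]
  induction s using Multiset.induction_on with
  | empty => rw [Multiset.map_zero, Multiset.filterMap_zero, Multiset.count_zero, Multiset.count_zero]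
  | cons a s ih =>
    rw [Multiset.map_cons]
    by_cases h : 0 < (a : ℕ) - 1
    · rw [Multiset.filterMap_cons_some _ _ _ (dif_pos h), Multiset.count_cons, Multiset.count_cons,
        ih]
      congr 1
      refine if_congr ?_ rfl rfl
      have : (Nat.toPNat ((a : ℕ) - 1) h : ℕ) = a - 1 := rfl
      rw [← PNat.coe_inj, ← PNat.coe_inj, PNat.add_coe, PNat.one_coe, this]
      omega
    · rw [Multiset.filterMap_cons_none _ _ (dif_neg h), ih, Multiset.count_cons_of_ne]
      intro h'
      apply h
      rw [← h', PNat.add_coe, PNat.one_coe, Nat.add_sub_cancel]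
      exact i.pos

/-- Matches the combinatorial column deletion with the lowering of exponents caused by
multiplication by t - 1. Parts 1 become exponent 0, which no `i : ℕ+` counts. -/
theorem count_removeColumnAtOne {ι : Type*} {p : ι → Phi F} {e : ι → ℕ}
    {μ : MultiPtn F} (hc : ∀ (r : Phi F) (i : ℕ+), Multiset.count i (μ r) = mult p e r i)
    (r : Phi F) (i : ℕ+) : Multiset.count i (removeColumnAtOne μ r) =
      mult p (lowerAt (tSubOne F) 1 p e) r i := by
  classical
  have hi := i.pos
  rw [removeColumnAtOne, Finsupp.coe_update]
  by_cases hr : r = tSubOne F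
  · rw [hr, Function.update_self, count_deleteColumn, hc]
    unfold mult lowerAt
    refine Nat.card_congr (Equiv.subtypeEquivRight fun j => and_congr_right fun hj => ?_)
    rw [if_pos hj, PNat.add_coe, PNat.one_coe]
    omega
  · rw [Function.update_of_ne hr, hc]
    unfold mult lowerAt
    refine Nat.card_congr (Equiv.subtypeEquivRight fun j => and_congr_right fun hj => ?_)
    rw [if_neg (fun h => hr (hj.symm.trans h))]

/-- The multiple `(t - 1) M` of a module. -/
abbrev reduced (F : Type*) [Field F] (M : Type*) [AddCommGroup M] [Module F[X] M] :
    Submodule F[X] M := smulRange (X - C 1 : F[X]) M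

theorem reduced_eq (M : Type*) [AddCommGroup M] [Module F[X] M] :
    reduced F M = smulRange ((tSubOne F).1 ^ 1) M := by
  rw [pow_one]; rfl

theorem HasElemDiv.reduced {μ : MultiPtn F} (h : HasElemDiv M μ) :
    HasElemDiv (reduced F M) (removeColumnAtOne μ) := by
  obtain ⟨k, p, e, hc, ⟨φ⟩⟩ := h.exists_primaryProd
  obtain ⟨ψ⟩ := nonempty_primaryProd_equiv_smulRange (tSubOne F) 1 p e
  rw [reduced_eq]
  exact hasElemDiv_of_primaryProd (count_removeColumnAtOne hc)
    ((smulRangeEquiv _ φ).trans ψ.symm)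

open Classical in
theorem tail_lowerAt {ι : Type*} (p : ι → Phi F) (e : ι → ℕ) (r s : Phi F) (i : ℕ) :
    tail p (lowerAt r 1 p e) s i = tail p e s (if s = r then i + 1 else i) := by
  unfold tail lowerAt
  refine Nat.card_congr (Equiv.subtypeEquivRight fun j => and_congr_right fun hj => ?_)
  rw [hj]
  split_ifs with h
  · omega
  · rfl

theorem natCard_smulRange_pow_zero (r : F[X]) : Nat.card (smulRange (r ^ 0) M) = Nat.card M := by
  have : smulRange (r ^ 0) M = ⊤ := by
    rw [eq_top_iff]
    exact fun x _ => mem_smulRange.2 ⟨x, by simp⟩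
  rw [this]
  exact Nat.card_congr Submodule.topEquiv.toEquiv

/-- Modules of the same size whose multiples by `t - 1` are isomorphic are isomorphic. -/
theorem HasElemDiv.nonempty_equiv_of_reduced [Finite F] {μ μ' : MultiPtn F} (h : HasElemDiv M μ)
    (h' : HasElemDiv M' μ') (f : StableCentre.reduced F M ≃ₗ[F[X]] StableCentre.reduced F M')
    (hcard : Nat.card M = Nat.card M') : Nonempty (M ≃ₗ[F[X]] M') := by
  obtain ⟨k, p, e, hc, ⟨φ⟩⟩ := h.exists_primaryProd
  obtain ⟨k', p', e', hc', ⟨φ'⟩⟩ := h'.exists_primaryProd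
  obtain ⟨ψ⟩ := nonempty_primaryProd_equiv_smulRange (tSubOne F) 1 p e
  obtain ⟨ψ'⟩ := nonempty_primaryProd_equiv_smulRange (tSubOne F) 1 p' e'
  have key : Nonempty (PrimaryProd p e ≃ₗ[F[X]] PrimaryProd p' e') := by
    apply nonempty_primaryProd_equiv
    apply mult_eq_of_tail_eq
    rw [reduced_eq, reduced_eq] at f
    have ht := tail_eq_of_equiv
      ((ψ.trans (smulRangeEquiv _ φ).symm).trans (f.trans ((smulRangeEquiv _ φ').trans ψ'.symm)))
    simp only [tail_lowerAt] at ht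
    intro r i
    -- The reduced modules give every tail except the one at t - 1 and i = 0, the number of (t -
    -- 1)-primary summands; that one is recovered from |M| and |(t - 1)M|.
    by_cases hr : r = tSubOne F
    · cases i with
      | zero =>
        refine tail_eq_of_card φ φ' r 0 ?_ ?_
        · rw [natCard_smulRange_pow_zero, natCard_smulRange_pow_zero, hcard]
        · rw [hr, zero_add]
          exact Nat.card_congr f.toEquiv
      | succ i => simpa [hr] using ht r i
    · simpa [hr] using ht r i
  obtain ⟨χ⟩ := key
  exact ⟨φ.trans (χ.trans φ'.symm)⟩

/-- Finitely generated torsion modules on which `t` is injective have elementary divisors. -/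
theorem exists_hasElemDiv [Module.Finite F[X] M] (ht : Module.IsTorsion F[X] M)
    (hX : Function.Injective fun x : M => (X : F[X]) • x) : ∃ μ : MultiPtn F, HasElemDiv M μ := by
  classical
  obtain ⟨ι, _, p, hp, e, ⟨φ⟩⟩ := Module.equiv_directSum_of_isTorsion ht
  have hspan (j : ι) : Ideal.span {p j ^ e j} = Ideal.span {normalize (p j) ^ e j} :=
    Ideal.span_singleton_eq_span_singleton.2 ((associated_normalize (p j)).pow_pow)
  have hirr (j : ι) : Irreducible (normalize (p j)) :=
    (associated_normalize (p j)).irreducible (hp j)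
  have hmonic (j : ι) : (normalize (p j)).Monic := monic_normalize (hp j).ne_zero
  -- If e_j = n + 1, the class of X^n is nonzero but killed by X, against injectivity.
  have he (j : ι) (hj : normalize (p j) = X) : e j = 0 := by
    by_contra h0
    obtain ⟨n, hn⟩ := Nat.exists_eq_succ_of_ne_zero h0
    let x : F[X] ⧸ Ideal.span {p j ^ e j} := Submodule.Quotient.mk (X ^ n)
    have hx : (X : F[X]) • x = 0 := by
      rw [← Submodule.Quotient.mk_smul, Submodule.Quotient.mk_eq_zero, smul_eq_mul, hspan, hj, hn,
        pow_succ']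
      exact Ideal.mem_span_singleton_self _
    have hx' : x = 0 := by
      have h1 : (X : F[X]) • φ.symm (DirectSum.lof F[X] ι
          (fun i => F[X] ⧸ Ideal.span {p i ^ e i}) j x) = (X : F[X]) • 0 := by
        rw [← map_smul, ← map_smul, hx, map_zero, map_zero, smul_zero]
      have h2 := hX h1
      rw [LinearEquiv.map_eq_zero_iff] at h2
      have h3 := DirectSum.component.lof_self F[X]
        (M := fun i => F[X] ⧸ Ideal.span {p i ^ e i}) j x
      rw [h2, map_zero] at h3
      exact h3.symm
    rw [Submodule.Quotient.mk_eq_zero, hspan, hj, hn, Ideal.mem_span_singleton] at hx'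
    have := (pow_dvd_pow_iff (X_ne_zero (R := F)) (not_isUnit_X)).1 hx'
    omega
  let p' : ι → Phi F := fun j => if h : normalize (p j) = X then tSubOne F else
    ⟨normalize (p j), hmonic j, hirr j, h⟩
  have hspan' (j : ι) : Ideal.span {p j ^ e j} = Ideal.span {(p' j).1 ^ e j} := by
    by_cases h : normalize (p j) = X
    · rw [he j h, pow_zero, pow_zero]
    · have : (p' j).1 = normalize (p j) := congrArg Subtype.val (dif_neg h)
      rw [this, hspan]
  obtain ⟨μ, hμ⟩ := exists_multiPtn p' e
  exact ⟨μ, hasElemDiv_of_primaryProd hμ ((φ.trans (DirectSum.linearEquivFunOnFintype _ _ _)).trans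
    (LinearEquiv.piCongrRight fun j => Submodule.quotEquivOfEq _ _ (hspan' j)))⟩

end ElemDiv

/-! ### Functions of `s` that are polynomial in `q ^ s` -/

/-- The functions of `s` that are polynomials in `q ^ s`. -/
def expPoly (q : ℚ) : Subalgebra ℚ (ℕ → ℚ) := (aeval (R := ℚ) fun s : ℕ => q ^ s).range

theorem mem_expPoly {q : ℚ} {f : ℕ → ℚ} :
    f ∈ expPoly q ↔ ∃ P : ℚ[X], ∀ s, f s = P.eval (q ^ s) := by
  have h (P : ℚ[X]) (s : ℕ) : aeval (fun s : ℕ => q ^ s) P s = P.eval (q ^ s) := by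
    rw [aeval_fn_apply, coe_aeval_eq_eval]
  constructor
  · rintro ⟨P, rfl⟩
    exact ⟨P, h P⟩
  · rintro ⟨P, hP⟩
    exact ⟨P, funext fun s => by rw [hP]; exact h P s⟩

theorem pow_mem_expPoly (q : ℚ) (d : ℕ) : (fun s : ℕ => (q ^ s) ^ d) ∈ expPoly q :=
  mem_expPoly.2 ⟨X ^ d, fun s => by simp⟩

open Classical in
/-- Möbius inversion: if the sums of `f` over all lower sets lie in a subring, then so do the
values of `f`. -/
theorem mem_of_sum_le_mem {L A : Type*} [Fintype L] [PartialOrder L] [Ring A]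
    (S : Subring A) (f : L → A) (h : ∀ x, ∑ y with y ≤ x, f y ∈ S) (x : L) : f x ∈ S := by
  induction x using WellFoundedLT.induction with
  | ind x ih =>
    have hx : (Finset.univ.filter fun y => y ≤ x) =
        insert x (Finset.univ.filter fun y => y < x) := by
      ext y
      simp [le_iff_eq_or_lt]
    have := h x
    rw [hx, Finset.sum_insert (by simp)] at this
    exact (add_mem_cancel_right (S.sum_mem fun y hy => ih y (by simpa using hy))).1 this

open Classical in
theorem natCard_and_comp {Y L : Type*} [Finite Y] [Fintype L] (Q : Y → Prop) (κ : Y → L)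
    (P : L → Prop) : Nat.card {y // Q y ∧ P (κ y)} =
      ∑ l with P l, Nat.card {y // Q y ∧ κ y = l} := by
  have := Fintype.ofFinite Y
  simp only [Nat.card_eq_fintype_card, Fintype.card_subtype]
  rw [Finset.card_eq_sum_card_fiberwise (f := κ) (t := Finset.univ.filter P)
    (by intro y hy; simpa using (Finset.mem_filter.1 hy).2.2)]
  refine Finset.sum_congr rfl fun l hl => ?_
  congr 1
  ext y
  simp only [Finset.mem_filter, Finset.mem_univ, true_and] at hl ⊢
  exact ⟨fun h => ⟨h.1.1, h.2⟩, fun h => ⟨⟨h.1, h.2 ▸ hl⟩, h.2⟩⟩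

open Classical in
theorem natCard_subtype_comp {Y L : Type*} [Finite Y] [Fintype L] (κ : Y → L) (P : L → Prop) :
    Nat.card {y // P (κ y)} = ∑ l with P l, Nat.card {y // κ y = l} := by
  simpa using natCard_and_comp (fun _ => True) κ P

/-! ### Counting linear maps -/

section Count

variable {F : Type*} [Field F] {E T : Type*} [AddCommGroup E] [Module F E] [AddCommGroup T]
  [Module F T]

theorem finite_linearMap [Finite F] [Module.Finite F E] [Module.Finite F T] :
    Finite (E →ₗ[F] T) :=
  Module.finite_of_finite F

theorem finite_submodule [Finite F] [Module.Finite F E] : Finite (Submodule F E) := by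
  have : Finite E := Module.finite_of_finite F
  exact Finite.of_injective (fun K : Submodule F E => (K : Set E)) SetLike.coe_injective

theorem natCard_linearMap [Module.Finite F E] [Module.Finite F T] :
    Nat.card (E →ₗ[F] T) = Nat.card F ^ (Module.finrank F E * Module.finrank F T) := by
  rw [Module.natCard_eq_pow_finrank (K := F), Module.finrank_linearMap]

/-- Linear maps that vanish on a subspace are the linear maps on the quotient. -/
def linearMapQuotientEquiv (K : Submodule F E) :
    {A : E →ₗ[F] T // K ≤ LinearMap.ker A} ≃ (E ⧸ K →ₗ[F] T) where
  toFun A := K.liftQ A.1 A.2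
  invFun A := ⟨A.comp K.mkQ, fun x hx => by
    rw [LinearMap.mem_ker, LinearMap.comp_apply, Submodule.mkQ_apply,
      (Submodule.Quotient.mk_eq_zero K).2 hx, map_zero]⟩
  left_inv A := Subtype.ext (K.liftQ_mkQ A.1 A.2)
  right_inv A := Submodule.linearMap_qext K (K.liftQ_mkQ _ _)

theorem natCard_le_ker [Module.Finite F E] [Module.Finite F T] (K : Submodule F E) :
    Nat.card {A : E →ₗ[F] T // K ≤ LinearMap.ker A} =
      Nat.card F ^ (Module.finrank F (E ⧸ K) * Module.finrank F T) := by
  rw [Nat.card_congr (linearMapQuotientEquiv K), natCard_linearMap]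

/-- The number of linear maps to `F ^ s` with a given kernel is a polynomial in `q ^ s`. -/
theorem natCard_ker_eq_mem_expPoly [Finite F] [Module.Finite F E] (K : Submodule F E) :
    (fun s : ℕ => (Nat.card {A : E →ₗ[F] (Fin s → F) // LinearMap.ker A = K} : ℚ)) ∈
      expPoly (Nat.card F) := by
  classical
  have : Finite (Submodule F E)ᵒᵈ := finite_submodule (F := F) (E := E)
  have := Fintype.ofFinite (Submodule F E)ᵒᵈ
  -- In the dual order the lower sums count maps whose kernel contains K, that is, Hom(E/K, F^s), of
  -- size (q^s)^dim(E/K).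
  refine mem_of_sum_le_mem (L := (Submodule F E)ᵒᵈ) (expPoly (Nat.card F)).toSubring
    (fun K s => (Nat.card {A : E →ₗ[F] (Fin s → F) // LinearMap.ker A = OrderDual.ofDual K} : ℚ))
    (fun K => ?_) (OrderDual.toDual K)
  suffices h : ∑ K' with K' ≤ K, (fun s : ℕ => (Nat.card {A : E →ₗ[F] (Fin s → F) //
      LinearMap.ker A = OrderDual.ofDual K'} : ℚ)) = fun s : ℕ =>
      ((Nat.card F : ℚ) ^ s) ^ Module.finrank F (E ⧸ OrderDual.ofDual K) by
    rw [h]; exact pow_mem_expPoly _ _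
  ext s
  have : Finite (E →ₗ[F] (Fin s → F)) := finite_linearMap
  have h1 := natCard_subtype_comp (fun A : E →ₗ[F] (Fin s → F) =>
    OrderDual.toDual (LinearMap.ker A)) (fun K' => K' ≤ K)
  have h2 := natCard_le_ker (T := Fin s → F) (OrderDual.ofDual K)
  rw [Finset.sum_apply, ← Nat.cast_sum, ← pow_mul]
  rw [Module.finrank_fin_fun, mul_comm] at h2
  rw [← Nat.cast_pow, ← h2]
  exact congrArg Nat.cast h1.symm

/-- The number of linear maps with values in `I` and prescribed composition with `A`. -/
theorem natCard_comp_eq [Module.Finite F E] [Module.Finite F T] {A : E →ₗ[F] T}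
    {I : Submodule F E} {Z : E →ₗ[F] E} (hK : LinearMap.ker A ≤ LinearMap.ker Z)
    (hI : LinearMap.range Z ≤ I) :
    Nat.card {B : T →ₗ[F] E // LinearMap.range B ≤ I ∧ B ∘ₗ A = Z} =
      Nat.card F ^ ((Module.finrank F T - Module.finrank F (E ⧸ LinearMap.ker A)) *
        Module.finrank F I) := by
  have hrank : Module.finrank F (T ⧸ LinearMap.range A) =
      Module.finrank F T - Module.finrank F (E ⧸ LinearMap.ker A) := by
    rw [A.quotKerEquivRange.finrank_eq, Submodule.finrank_quotient]
  rw [← hrank, ← natCard_le_ker]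
  let Z' : E →ₗ[F] I := Z.codRestrict I fun x => hI ⟨x, rfl⟩
  -- A particular solution: Z factors through E / ker A ≅ range A, and the resulting map extends to
  -- T. The differences B - B₀ are the maps T / range A → I.
  obtain ⟨B₀, hB₀⟩ : ∃ B₀ : T →ₗ[F] I, B₀ ∘ₗ A = Z' := by
    have hZ' : LinearMap.ker A ≤ LinearMap.ker Z' := by rwa [LinearMap.ker_codRestrict]
    obtain ⟨G, hG⟩ := LinearMap.exists_extend
      (((LinearMap.ker A).liftQ Z' hZ').comp A.quotKerEquivRange.symm.toLinearMap)
    refine ⟨G, LinearMap.ext fun x => ?_⟩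
    have := LinearMap.congr_fun hG ⟨A x, x, rfl⟩
    rw [LinearMap.comp_apply] at this
    refine Eq.trans this ?_
    have h2 : A.quotKerEquivRange.symm ⟨A x, x, rfl⟩ = Submodule.Quotient.mk x :=
      A.quotKerEquivRange_symm_apply_image x ⟨x, rfl⟩
    rw [LinearMap.comp_apply, LinearEquiv.coe_coe, h2]
    rfl
  refine Nat.card_congr ⟨fun B => ⟨B.1.codRestrict I (fun x => B.2.1 ⟨x, rfl⟩) - B₀, ?_⟩,
    fun C => ⟨I.subtype ∘ₗ (C.1 + B₀), ?_, ?_⟩, fun B => ?_, fun C => ?_⟩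
  · rintro _ ⟨x, rfl⟩
    have h1 := LinearMap.congr_fun hB₀ x
    have h2 := LinearMap.congr_fun B.2.2 x
    rw [LinearMap.mem_ker, LinearMap.sub_apply, sub_eq_zero]
    refine Subtype.ext ?_
    rw [LinearMap.comp_apply] at h1 h2
    rw [h1]
    exact h2
  · rintro _ ⟨x, rfl⟩
    exact ((C.1 + B₀) x).2
  · ext x
    have h1 := LinearMap.congr_fun hB₀ x
    have h2 : C.1 (A x) = 0 := C.2 ⟨x, rfl⟩
    rw [LinearMap.comp_apply] at h1
    simp only [LinearMap.comp_apply, LinearMap.add_apply, h1, h2, zero_add]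
    rfl
  · refine Subtype.ext (LinearMap.ext fun x => ?_)
    simp
  · refine Subtype.ext (LinearMap.ext fun x => ?_)
    simp only [LinearMap.sub_apply, sub_eq_iff_eq_add]
    rfl

theorem finrank_quotient_ker_le [Module.Finite F E] [Module.Finite F T] (A : E →ₗ[F] T) :
    Module.finrank F (E ⧸ LinearMap.ker A) ≤ Module.finrank F T := by
  rw [A.quotKerEquivRange.finrank_eq]
  exact Submodule.finrank_le _

/-- If Z kills K and lands in I, the number of B depends only on the rank of A, that is on K, and is
a constant times (q^s)^(dim I). Otherwise there are no pairs. -/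
theorem natCard_ker_eq_range_le_mem_expPoly [Finite F] [Module.Finite F E] (K I : Submodule F E)
    (Z : E →ₗ[F] E) :
    (fun s : ℕ => (Nat.card {y : (E →ₗ[F] (Fin s → F)) × ((Fin s → F) →ₗ[F] E) //
      LinearMap.ker y.1 = K ∧ LinearMap.range y.2 ≤ I ∧ y.2 ∘ₗ y.1 = Z} : ℚ)) ∈
      expPoly (Nat.card F) := by
  by_cases h : K ≤ LinearMap.ker Z ∧ LinearMap.range Z ≤ I
  · have hq : (Nat.card F : ℚ) ≠ 0 := Nat.cast_ne_zero.2 Nat.card_pos.ne'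
    have key (s : ℕ) : (Nat.card {y : (E →ₗ[F] (Fin s → F)) × ((Fin s → F) →ₗ[F] E) //
        LinearMap.ker y.1 = K ∧ LinearMap.range y.2 ≤ I ∧ y.2 ∘ₗ y.1 = Z} : ℚ) =
        (Nat.card {A : E →ₗ[F] (Fin s → F) // LinearMap.ker A = K} : ℚ) *
          (((Nat.card F : ℚ) ^ s) ^ Module.finrank F I) *
          ((Nat.card F : ℚ) ^ (Module.finrank F (E ⧸ K) * Module.finrank F I))⁻¹ := by
      have : Finite (E →ₗ[F] (Fin s → F)) := finite_linearMap
      have := Fintype.ofFinite {A : E →ₗ[F] (Fin s → F) // LinearMap.ker A = K}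
      let σ : {y : (E →ₗ[F] (Fin s → F)) × ((Fin s → F) →ₗ[F] E) //
          LinearMap.ker y.1 = K ∧ LinearMap.range y.2 ≤ I ∧ y.2 ∘ₗ y.1 = Z} ≃
          Σ A : {A : E →ₗ[F] (Fin s → F) // LinearMap.ker A = K},
            {B : (Fin s → F) →ₗ[F] E // LinearMap.range B ≤ I ∧ B ∘ₗ A.1 = Z} :=
        { toFun := fun y => ⟨⟨y.1.1, y.2.1⟩, ⟨y.1.2, y.2.2⟩⟩
          invFun := fun y => ⟨(y.1.1, y.2.1), y.1.2, y.2.2⟩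
          left_inv := fun _ => rfl
          right_inv := fun _ => rfl }
      have : Finite ((Fin s → F) →ₗ[F] E) := finite_linearMap
      rw [Nat.card_congr σ, Nat.card_sigma, Nat.cast_sum, Nat.card_eq_fintype_card, mul_assoc,
        ← nsmul_eq_mul, ← Finset.card_univ, ← Finset.sum_const]
      refine Finset.sum_congr rfl fun A _ => ?_
      obtain ⟨A, rfl⟩ := A
      -- The existence of A forces dim(E/K) ≤ s, so the truncated subtraction in the exponent is
      -- exact; for smaller s both sides are empty sums.
      have hle := finrank_quotient_ker_le A
      rw [natCard_comp_eq h.1 h.2, Nat.cast_pow, eq_mul_inv_iff_mul_eq₀ (pow_ne_zero _ hq),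
        ← pow_add, ← add_mul, Nat.sub_add_cancel hle, Module.finrank_fin_fun, pow_mul]
    have := Subalgebra.mul_mem _ (Subalgebra.mul_mem _ (natCard_ker_eq_mem_expPoly K)
      (pow_mem_expPoly (Nat.card F) (Module.finrank F I)))
      (Subalgebra.algebraMap_mem (expPoly (Nat.card F))
        ((Nat.card F : ℚ) ^ (Module.finrank F (E ⧸ K) * Module.finrank F I))⁻¹)
    convert! this using 1
    exact funext key
  · have h0 (s : ℕ) : IsEmpty {y : (E →ₗ[F] (Fin s → F)) × ((Fin s → F) →ₗ[F] E) //
        LinearMap.ker y.1 = K ∧ LinearMap.range y.2 ≤ I ∧ y.2 ∘ₗ y.1 = Z} := by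
      refine ⟨fun ⟨⟨A, B⟩, h1, h2, h3⟩ => h ⟨?_, ?_⟩⟩
      · subst h1 h3
        exact fun x hx => by
          rw [LinearMap.mem_ker, LinearMap.comp_apply, LinearMap.mem_ker.1 hx, map_zero]
      · subst h3
        exact (LinearMap.range_comp_le_range _ _).trans h2
    simp only [Nat.card_of_isEmpty, Nat.cast_zero]
    exact Subalgebra.zero_mem _

/-- The number of pairs of linear maps `E → F ^ s → E` with given kernel, range and composition is
a polynomial in `q ^ s`. -/
theorem natCard_ker_eq_range_eq_mem_expPoly [Finite F] [Module.Finite F E] (K I : Submodule F E)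
    (Z : E →ₗ[F] E) :
    (fun s : ℕ => (Nat.card {y : (E →ₗ[F] (Fin s → F)) × ((Fin s → F) →ₗ[F] E) //
      LinearMap.ker y.1 = K ∧ LinearMap.range y.2 = I ∧ y.2 ∘ₗ y.1 = Z} : ℚ)) ∈
      expPoly (Nat.card F) := by
  classical
  have : Finite (Submodule F E) := finite_submodule
  have := Fintype.ofFinite (Submodule F E)
  -- Möbius inversion over I passes from range contained in I to range equal to I.
  refine mem_of_sum_le_mem (expPoly (Nat.card F)).toSubring
    (fun I s => (Nat.card {y : (E →ₗ[F] (Fin s → F)) × ((Fin s → F) →ₗ[F] E) //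
      LinearMap.ker y.1 = K ∧ LinearMap.range y.2 = I ∧ y.2 ∘ₗ y.1 = Z} : ℚ)) (fun I => ?_) I
  convert! natCard_ker_eq_range_le_mem_expPoly K I Z using 1
  ext s
  have : Finite (E →ₗ[F] (Fin s → F)) := finite_linearMap
  have : Finite ((Fin s → F) →ₗ[F] E) := finite_linearMap
  rw [Finset.sum_apply, ← Nat.cast_sum, Nat.cast_inj]
  have h1 := natCard_and_comp (fun y : (E →ₗ[F] (Fin s → F)) × ((Fin s → F) →ₗ[F] E) =>
    LinearMap.ker y.1 = K ∧ y.2 ∘ₗ y.1 = Z) (fun y => LinearMap.range y.2) (fun I' => I' ≤ I)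
  refine (Finset.sum_congr rfl fun I' _ => ?_).trans (h1.symm.trans ?_)
  · exact Nat.card_congr (Equiv.subtypeEquivRight fun y => by tauto)
  · exact Nat.card_congr (Equiv.subtypeEquivRight fun y => by tauto)

end Count

/-! ### Counting factorisations of pairs -/

section Factor

variable {F : Type*} [Field F]
variable {E₁ E₂ E V V₀ : Type*} [AddCommGroup E₁] [Module F E₁] [AddCommGroup E₂] [Module F E₂]
  [AddCommGroup E] [Module F E] [AddCommGroup V] [Module F V] [AddCommGroup V₀] [Module F V₀]

theorem exists_factorization [Module.Finite F E] [Module.Finite F V] (x : Module.End F V)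
    (hx : Module.finrank F (LinearMap.range x) = Module.finrank F E) :
    ∃ (u : E →ₗ[F] V) (v : V →ₗ[F] E), Function.Injective u ∧ Function.Surjective v ∧
      u ∘ₗ v = x := by
  let θ : E ≃ₗ[F] LinearMap.range x := LinearEquiv.ofFinrankEq _ _ hx.symm
  exact ⟨(LinearMap.range x).subtype ∘ₗ θ.toLinearMap, θ.symm.toLinearMap ∘ₗ x.rangeRestrict,
    Subtype.val_injective.comp θ.injective, θ.symm.surjective.comp x.surjective_rangeRestrict,
    LinearMap.ext fun w => by simp⟩

/-- The number of full rank factorisations through `E` of an endomorphism of rank `dim E`. -/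
theorem natCard_factorizations [Module.Finite F E] [Module.Finite F V] (x : Module.End F V)
    (hx : Module.finrank F (LinearMap.range x) = Module.finrank F E) :
    Nat.card {y : (E →ₗ[F] V) × (V →ₗ[F] E) //
      Function.Injective y.1 ∧ Function.Surjective y.2 ∧ y.1 ∘ₗ y.2 = x} =
      Nat.card (E ≃ₗ[F] E) := by
  obtain ⟨u, v, hu, hv, huv⟩ := exists_factorization x hx
  have hcomp (P : E ≃ₗ[F] E) : (u ∘ₗ P.toLinearMap) ∘ₗ (P.symm.toLinearMap ∘ₗ v) = x := by
    rw [← huv]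
    ext w
    simp
  -- Any other factorisation is (uP, P⁻¹v) for a unique P, because both injections have the range of
  -- x.
  refine (Nat.card_congr (Equiv.ofBijective (fun P : E ≃ₗ[F] E =>
    ⟨(u ∘ₗ P.toLinearMap, P.symm.toLinearMap ∘ₗ v), hu.comp P.injective,
      P.symm.surjective.comp hv, hcomp P⟩) ⟨?_, ?_⟩)).symm
  · intro P Q h
    ext w
    have := LinearMap.congr_fun (congrArg Prod.fst (congrArg Subtype.val h)) w
    exact hu this
  · rintro ⟨⟨u', v'⟩, hu', hv', h⟩
    simp only at hu' hv' h
    have hr : LinearMap.range u' = LinearMap.range x := by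
      rw [← h, LinearMap.range_comp, LinearMap.range_eq_top.2 hv', Submodule.map_top]
    have hr' : LinearMap.range u = LinearMap.range x := by
      rw [← huv, LinearMap.range_comp, LinearMap.range_eq_top.2 hv, Submodule.map_top]
    let P : E ≃ₗ[F] E := ((LinearEquiv.ofInjective u' hu').trans
      (LinearEquiv.ofEq _ _ (hr.trans hr'.symm))).trans (LinearEquiv.ofInjective u hu).symm
    have hP (w : E) : u (P w) = u' w :=
      congrArg Subtype.val ((LinearEquiv.ofInjective u hu).apply_symm_apply _)
    refine ⟨P, Subtype.ext (Prod.ext (LinearMap.ext hP) (LinearMap.ext fun w => ?_))⟩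
    refine (LinearEquiv.symm_apply_eq P).2 (hu ?_)
    rw [hP]
    exact (LinearMap.congr_fun huv w).trans (LinearMap.congr_fun h w).symm

/-- Pairs of full rank factorisations `u₁ v₁ = a - 1`, `u₂ v₂ = b - 1`, where `a b = g` and `v₁ u₁`,
`v₂ u₂` satisfy given conditions. -/
def IsGoodQuad (P₁ : Module.End F E₁ → Prop) (P₂ : Module.End F E₂ → Prop) (g : Module.End F V)
    (u₁ : E₁ →ₗ[F] V) (u₂ : E₂ →ₗ[F] V) (v₁ : V →ₗ[F] E₁) (v₂ : V →ₗ[F] E₂) : Prop :=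
  Function.Injective u₁ ∧ Function.Injective u₂ ∧ Function.Surjective v₁ ∧ Function.Surjective v₂ ∧
    P₁ (v₁ ∘ₗ u₁) ∧ P₂ (v₂ ∘ₗ u₂) ∧ (1 + u₁ ∘ₗ v₁) * (1 + u₂ ∘ₗ v₂) = g

/-- Counting pairs of endomorphisms with product `g` by counting pairs of factorisations. -/
theorem natCard_isGoodQuad [Finite F] [Module.Finite F E₁] [Module.Finite F E₂] [Module.Finite F V]
    (P₁ : Module.End F E₁ → Prop) (P₂ : Module.End F E₂ → Prop) (Q₁ Q₂ : Module.End F V → Prop)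
    (h₁ : ∀ (u : E₁ →ₗ[F] V) (v : V →ₗ[F] E₁), Function.Injective u → Function.Surjective v →
      (Q₁ (1 + u ∘ₗ v) ↔ P₁ (v ∘ₗ u)))
    (h₂ : ∀ (u : E₂ →ₗ[F] V) (v : V →ₗ[F] E₂), Function.Injective u → Function.Surjective v →
      (Q₂ (1 + u ∘ₗ v) ↔ P₂ (v ∘ₗ u)))
    (hr₁ : ∀ a, Q₁ a → Module.finrank F (LinearMap.range (a - 1)) = Module.finrank F E₁)
    (hr₂ : ∀ a, Q₂ a → Module.finrank F (LinearMap.range (a - 1)) = Module.finrank F E₂)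
    (g : Module.End F V) :
    Nat.card {y : ((E₁ →ₗ[F] V) × (E₂ →ₗ[F] V)) × ((V →ₗ[F] E₁) × (V →ₗ[F] E₂)) //
      IsGoodQuad P₁ P₂ g y.1.1 y.1.2 y.2.1 y.2.2} =
    Nat.card {ab : Module.End F V × Module.End F V // ab.1 * ab.2 = g ∧ Q₁ ab.1 ∧ Q₂ ab.2} *
      (Nat.card (E₁ ≃ₗ[F] E₁) * Nat.card (E₂ ≃ₗ[F] E₂)) := by
  classical
  have i₁ : Finite (E₁ →ₗ[F] V) := finite_linearMap
  have i₂ : Finite (E₂ →ₗ[F] V) := finite_linearMap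
  have i₃ : Finite (V →ₗ[F] E₁) := finite_linearMap
  have i₄ : Finite (V →ₗ[F] E₂) := finite_linearMap
  have i₅ : Finite (Module.End F V) := finite_linearMap
  have := Fintype.ofFinite (Module.End F V)
  -- The factorisations are fibred over (a, b) = (1 + u₁v₁, 1 + u₂v₂); all fibres have size |GL(E₁)|
  -- |GL(E₂)|.
  have h := natCard_and_comp
    (fun y : ((E₁ →ₗ[F] V) × (E₂ →ₗ[F] V)) × ((V →ₗ[F] E₁) × (V →ₗ[F] E₂)) =>
      (Function.Injective y.1.1 ∧ Function.Surjective y.2.1) ∧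
        (Function.Injective y.1.2 ∧ Function.Surjective y.2.2))
    (fun y => ((1 + y.1.1 ∘ₗ y.2.1, 1 + y.1.2 ∘ₗ y.2.2) : Module.End F V × Module.End F V))
    (fun ab => ab.1 * ab.2 = g ∧ Q₁ ab.1 ∧ Q₂ ab.2)
  refine Eq.trans ?_ (h.trans ?_)
  · refine Nat.card_congr (Equiv.subtypeEquivRight fun y => ?_)
    unfold IsGoodQuad
    constructor
    · rintro ⟨a, b, c, d, e, f, k⟩
      exact ⟨⟨⟨a, c⟩, b, d⟩, k, (h₁ _ _ a c).2 e, (h₂ _ _ b d).2 f⟩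
    · rintro ⟨⟨⟨a, c⟩, b, d⟩, k, e, f⟩
      exact ⟨a, b, c, d, (h₁ _ _ a c).1 e, (h₂ _ _ b d).1 f, k⟩
  · rw [Nat.card_eq_fintype_card (α := {ab : Module.End F V × Module.End F V //
      ab.1 * ab.2 = g ∧ Q₁ ab.1 ∧ Q₂ ab.2}), Fintype.card_subtype, ← smul_eq_mul,
      ← Finset.sum_const]
    refine Finset.sum_congr (by congr) fun ab hab => ?_
    obtain ⟨a, b⟩ := ab
    obtain ⟨-, ha, hb⟩ := (Finset.mem_filter.1 hab).2
    rw [← natCard_factorizations (a - 1) (hr₁ a ha), ← natCard_factorizations (b - 1) (hr₂ b hb),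
      ← Nat.card_prod]
    refine Nat.card_congr ⟨fun y => (⟨(y.1.1.1, y.1.2.1), y.2.1.1.1, y.2.1.1.2, ?_⟩,
      ⟨(y.1.1.2, y.1.2.2), y.2.1.2.1, y.2.1.2.2, ?_⟩),
      fun y => ⟨((y.1.1.1, y.2.1.1), (y.1.1.2, y.2.1.2)),
        ⟨⟨y.1.2.1, y.1.2.2.1⟩, y.2.2.1, y.2.2.2.1⟩, ?_⟩, fun _ => rfl, fun _ => rfl⟩
    · exact eq_sub_of_add_eq' (congrArg Prod.fst y.2.2)
    · exact eq_sub_of_add_eq' (congrArg Prod.snd y.2.2)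
    · exact Prod.ext (add_eq_of_eq_sub' y.1.2.2.2) (add_eq_of_eq_sub' y.2.2.2.2)

/-- The map `z ↦ z + ((Y (0, z₂))₁, 0)`. -/
def twist (Y : Module.End F (E₁ × E₂)) : Module.End F (E₁ × E₂) :=
  1 + LinearMap.inl F E₁ E₂ ∘ₗ LinearMap.fst F E₁ E₂ ∘ₗ Y ∘ₗ LinearMap.inr F E₁ E₂ ∘ₗ
    LinearMap.snd F E₁ E₂

/-- Expanding the product, u₁v₁ + u₂v₂ is UW, and `twist` supplies the cross term u₁v₁u₂v₂, which
involves only the block v₁u₂ of WU. -/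
theorem one_add_mul_one_add_apply (U : E₁ × E₂ →ₗ[F] V) (W : V →ₗ[F] E₁ × E₂) (w : V) :
    ((1 + (U ∘ₗ LinearMap.inl F E₁ E₂) ∘ₗ (LinearMap.fst F E₁ E₂ ∘ₗ W) : Module.End F V) *
      (1 + (U ∘ₗ LinearMap.inr F E₁ E₂) ∘ₗ (LinearMap.snd F E₁ E₂ ∘ₗ W))) w =
      w + U (twist (W ∘ₗ U) (W w)) := by
  have h (z : E₁ × E₂) : z = LinearMap.inl F E₁ E₂ z.1 + LinearMap.inr F E₁ E₂ z.2 := by simp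
  simp only [twist, Module.End.mul_apply, LinearMap.add_apply, Module.End.one_apply,
    LinearMap.comp_apply, map_add, LinearMap.fst_apply, LinearMap.snd_apply]
  have h' := congrArg U (h (W w))
  rw [map_add] at h'
  rw [h']
  abel

variable (P₁ : Module.End F E₁ → Prop) (P₂ : Module.End F E₂ → Prop) (g₀ : Module.End F V₀)

/-- The condition `IsGoodQuad` for `V = V₀ × T` and `g` trivial on `T`, in terms of the components
at `V₀`, and the kernel, the range and the composition of the components at `T`. -/
def IsGoodData (U₀ : E₁ × E₂ →ₗ[F] V₀) (W₀ : V₀ →ₗ[F] E₁ × E₂) (K I : Submodule F (E₁ × E₂))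
    (Z : Module.End F (E₁ × E₂)) : Prop :=
  (∀ x : E₁, U₀ (x, 0) = 0 → (x, (0 : E₂)) ∈ K → x = 0) ∧
  (∀ x : E₂, U₀ (0, x) = 0 → ((0 : E₁), x) ∈ K → x = 0) ∧
  (LinearMap.range W₀ ⊔ I).map (LinearMap.fst F E₁ E₂) = ⊤ ∧
  (LinearMap.range W₀ ⊔ I).map (LinearMap.snd F E₁ E₂) = ⊤ ∧
  P₁ (LinearMap.fst F E₁ E₂ ∘ₗ (W₀ ∘ₗ U₀ + Z) ∘ₗ LinearMap.inl F E₁ E₂) ∧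
  P₂ (LinearMap.snd F E₁ E₂ ∘ₗ (W₀ ∘ₗ U₀ + Z) ∘ₗ LinearMap.inr F E₁ E₂) ∧
  (∀ v, v + U₀ (twist (W₀ ∘ₗ U₀ + Z) (W₀ v)) = g₀ v) ∧
  (∀ x ∈ I, U₀ (twist (W₀ ∘ₗ U₀ + Z) x) = 0) ∧
  (∀ v, twist (W₀ ∘ₗ U₀ + Z) (W₀ v) ∈ K) ∧
  (∀ x ∈ I, twist (W₀ ∘ₗ U₀ + Z) x ∈ K)

/-- Injectivity sees A only through its kernel, surjectivity sees B only through its range, and the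
maps v_i u_i are diagonal blocks of W₀U₀ + BA. The product condition splits into four blocks; the
two with target T say that certain vectors lie in ker A. -/
theorem isGoodQuad_iff_isGoodData {T : Type*} [AddCommGroup T] [Module F T]
    (U₀ : E₁ × E₂ →ₗ[F] V₀) (W₀ : V₀ →ₗ[F] E₁ × E₂)
    (A : E₁ × E₂ →ₗ[F] T) (B : T →ₗ[F] E₁ × E₂) :
    IsGoodQuad P₁ P₂ (g₀.prodMap LinearMap.id : Module.End F (V₀ × T))
      (U₀.prod A ∘ₗ LinearMap.inl F E₁ E₂) (U₀.prod A ∘ₗ LinearMap.inr F E₁ E₂)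
      (LinearMap.fst F E₁ E₂ ∘ₗ W₀.coprod B) (LinearMap.snd F E₁ E₂ ∘ₗ W₀.coprod B) ↔
    IsGoodData P₁ P₂ g₀ U₀ W₀ (LinearMap.ker A) (LinearMap.range B) (B ∘ₗ A) := by
  have hY : W₀.coprod B ∘ₗ U₀.prod A = W₀ ∘ₗ U₀ + B ∘ₗ A := LinearMap.coprod_comp_prod _ _ _ _
  have hinj₁ : Function.Injective (U₀.prod A ∘ₗ LinearMap.inl F E₁ E₂) ↔
      ∀ x : E₁, U₀ (x, 0) = 0 → (x, (0 : E₂)) ∈ LinearMap.ker A → x = 0 := by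
    rw [injective_iff_map_eq_zero]
    simp
  have hinj₂ : Function.Injective (U₀.prod A ∘ₗ LinearMap.inr F E₁ E₂) ↔
      ∀ x : E₂, U₀ (0, x) = 0 → ((0 : E₁), x) ∈ LinearMap.ker A → x = 0 := by
    rw [injective_iff_map_eq_zero]
    simp
  have hsurj₁ : Function.Surjective (LinearMap.fst F E₁ E₂ ∘ₗ W₀.coprod B) ↔
      (LinearMap.range W₀ ⊔ LinearMap.range B).map (LinearMap.fst F E₁ E₂) = ⊤ := by
    rw [← LinearMap.range_eq_top, LinearMap.range_comp, LinearMap.range_coprod]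
  have hsurj₂ : Function.Surjective (LinearMap.snd F E₁ E₂ ∘ₗ W₀.coprod B) ↔
      (LinearMap.range W₀ ⊔ LinearMap.range B).map (LinearMap.snd F E₁ E₂) = ⊤ := by
    rw [← LinearMap.range_eq_top, LinearMap.range_comp, LinearMap.range_coprod]
  have hcomp₁ : (LinearMap.fst F E₁ E₂ ∘ₗ W₀.coprod B) ∘ₗ (U₀.prod A ∘ₗ LinearMap.inl F E₁ E₂) =
      LinearMap.fst F E₁ E₂ ∘ₗ (W₀ ∘ₗ U₀ + B ∘ₗ A) ∘ₗ LinearMap.inl F E₁ E₂ := by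
    rw [← hY]; rfl
  have hcomp₂ : (LinearMap.snd F E₁ E₂ ∘ₗ W₀.coprod B) ∘ₗ (U₀.prod A ∘ₗ LinearMap.inr F E₁ E₂) =
      LinearMap.snd F E₁ E₂ ∘ₗ (W₀ ∘ₗ U₀ + B ∘ₗ A) ∘ₗ LinearMap.inr F E₁ E₂ := by
    rw [← hY]; rfl
  unfold IsGoodQuad IsGoodData
  rw [hinj₁, hinj₂, hsurj₁, hsurj₂, hcomp₁, hcomp₂, LinearMap.ext_iff]
  refine and_congr_right fun _ => and_congr_right fun _ => and_congr_right fun _ =>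
    and_congr_right fun _ => and_congr_right fun _ => and_congr_right fun _ => ?_
  simp only [one_add_mul_one_add_apply, hY]
  generalize twist (W₀ ∘ₗ U₀ + B ∘ₗ A) = J
  constructor
  · intro h
    have h1 (v : V₀) := h (v, 0)
    have h2 (t : T) := h (0, t)
    simp only [LinearMap.coprod_apply, map_zero, add_zero, zero_add, LinearMap.prod_apply,
      Function.prod_apply, LinearMap.prodMap_apply, LinearMap.id_apply, Prod.mk_add_mk, Prod.mk.injEq,
      add_eq_left] at h1 h2
    refine ⟨fun v => (h1 v).1, ?_, fun v => LinearMap.mem_ker.2 (h1 v).2, ?_⟩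
    · rintro _ ⟨t, rfl⟩
      exact (h2 t).1
    · rintro _ ⟨t, rfl⟩
      exact LinearMap.mem_ker.2 (h2 t).2
  · rintro ⟨h1, h2, h3, h4⟩ ⟨v, t⟩
    have h2' := h2 (B t) ⟨t, rfl⟩
    have h3' := LinearMap.mem_ker.1 (h3 v)
    have h4' := LinearMap.mem_ker.1 (h4 (B t) ⟨t, rfl⟩)
    simp only [LinearMap.coprod_apply, map_add, LinearMap.prod_apply, Function.prod_apply,
      LinearMap.prodMap_apply, LinearMap.id_apply, Prod.mk_add_mk, h2', h3', h4', add_zero, h1]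

/-- The number of pairs of factorisations, for `g` extended by the identity of `F ^ s`, is a
polynomial in `q ^ s`. -/
theorem natCard_isGoodQuad_mem_expPoly [Finite F] [Module.Finite F E₁] [Module.Finite F E₂]
    [Module.Finite F V₀] :
    (fun s : ℕ => (Nat.card {y : ((E₁ →ₗ[F] V₀ × (Fin s → F)) × (E₂ →ₗ[F] V₀ × (Fin s → F))) ×
        ((V₀ × (Fin s → F) →ₗ[F] E₁) × (V₀ × (Fin s → F) →ₗ[F] E₂)) //
      IsGoodQuad P₁ P₂ (g₀.prodMap LinearMap.id : Module.End F (V₀ × (Fin s → F)))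
        y.1.1 y.1.2 y.2.1 y.2.2} : ℚ)) ∈ expPoly (Nat.card F) := by
  classical
  have i₁ : Finite (E₁ × E₂ →ₗ[F] V₀) := finite_linearMap
  have i₂ : Finite (V₀ →ₗ[F] E₁ × E₂) := finite_linearMap
  have i₃ : Finite (Submodule F (E₁ × E₂)) := finite_submodule
  have i₄ : Finite (Module.End F (E₁ × E₂)) := finite_linearMap
  -- The finite set of possible data, independent of s.
  let L := ((E₁ × E₂ →ₗ[F] V₀) × (V₀ →ₗ[F] E₁ × E₂)) ×
    (Submodule F (E₁ × E₂) × Submodule F (E₁ × E₂) × Module.End F (E₁ × E₂))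
  have i₅ : Finite L := inferInstance
  have := Fintype.ofFinite L
  have key (s : ℕ) : Nat.card {y : ((E₁ →ₗ[F] V₀ × (Fin s → F)) × (E₂ →ₗ[F] V₀ × (Fin s → F))) ×
        ((V₀ × (Fin s → F) →ₗ[F] E₁) × (V₀ × (Fin s → F) →ₗ[F] E₂)) //
      IsGoodQuad P₁ P₂ (g₀.prodMap LinearMap.id : Module.End F (V₀ × (Fin s → F)))
        y.1.1 y.1.2 y.2.1 y.2.2} =
      ∑ l : L with IsGoodData P₁ P₂ g₀ l.1.1 l.1.2 l.2.1 l.2.2.1 l.2.2.2,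
        Nat.card {y : (E₁ × E₂ →ₗ[F] (Fin s → F)) × ((Fin s → F) →ₗ[F] E₁ × E₂) //
          LinearMap.ker y.1 = l.2.1 ∧ LinearMap.range y.2 = l.2.2.1 ∧ y.2 ∘ₗ y.1 = l.2.2.2} := by
    have i₆ : Finite (E₁ × E₂ →ₗ[F] (Fin s → F)) := finite_linearMap
    have i₇ : Finite ((Fin s → F) →ₗ[F] E₁ × E₂) := finite_linearMap
    let κ (y : ((E₁ × E₂ →ₗ[F] V₀) × (V₀ →ₗ[F] E₁ × E₂)) ×
        ((E₁ × E₂ →ₗ[F] (Fin s → F)) × ((Fin s → F) →ₗ[F] E₁ × E₂))) : L :=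
      (y.1, LinearMap.ker y.2.1, LinearMap.range y.2.2, y.2.2 ∘ₗ y.2.1)
    have h := natCard_subtype_comp κ
      (fun l => IsGoodData P₁ P₂ g₀ l.1.1 l.1.2 l.2.1 l.2.2.1 l.2.2.2)
    refine Eq.trans ?_ (h.trans (Finset.sum_congr rfl fun l _ => ?_))
    · symm
      let σ : (((E₁ × E₂ →ₗ[F] V₀) × (V₀ →ₗ[F] E₁ × E₂)) ×
          ((E₁ × E₂ →ₗ[F] (Fin s → F)) × ((Fin s → F) →ₗ[F] E₁ × E₂))) ≃
          ((E₁ →ₗ[F] V₀ × (Fin s → F)) × (E₂ →ₗ[F] V₀ × (Fin s → F))) ×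
            ((V₀ × (Fin s → F) →ₗ[F] E₁) × (V₀ × (Fin s → F) →ₗ[F] E₂)) :=
        { toFun := fun y => ((y.1.1.prod y.2.1 ∘ₗ LinearMap.inl F E₁ E₂,
              y.1.1.prod y.2.1 ∘ₗ LinearMap.inr F E₁ E₂),
            (LinearMap.fst F E₁ E₂ ∘ₗ y.1.2.coprod y.2.2,
              LinearMap.snd F E₁ E₂ ∘ₗ y.1.2.coprod y.2.2))
          invFun := fun y => ((LinearMap.fst F _ _ ∘ₗ y.1.1.coprod y.1.2,
              y.2.1.prod y.2.2 ∘ₗ LinearMap.inl F _ _),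
            (LinearMap.snd F _ _ ∘ₗ y.1.1.coprod y.1.2,
              y.2.1.prod y.2.2 ∘ₗ LinearMap.inr F _ _))
          left_inv := fun y => by
            refine Prod.ext (Prod.ext ?_ ?_) (Prod.ext ?_ ?_) <;> ext <;> simp
          right_inv := fun y => by
            refine Prod.ext (Prod.ext ?_ ?_) (Prod.ext ?_ ?_) <;> ext <;> simp }
      exact Nat.card_congr (σ.subtypeEquiv fun y =>
        (isGoodQuad_iff_isGoodData P₁ P₂ g₀ y.1.1 y.1.2 y.2.1 y.2.2).symm)
    · obtain ⟨l, K, I, Z⟩ := l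
      exact Nat.card_congr ⟨fun y => ⟨y.1.2, congrArg (fun l : L => l.2.1) y.2,
        congrArg (fun l : L => l.2.2.1) y.2, congrArg (fun l : L => l.2.2.2) y.2⟩,
        fun y => ⟨(l, y.1), Prod.ext rfl (Prod.ext y.2.1 (Prod.ext y.2.2.1 y.2.2.2))⟩,
        fun y => Subtype.ext (Prod.ext (congrArg (fun l : L => l.1) y.2).symm rfl), fun _ => rfl⟩
  have hmem := Subalgebra.sum_mem (expPoly (Nat.card F))
    (t := Finset.univ.filter fun l : L => IsGoodData P₁ P₂ g₀ l.1.1 l.1.2 l.2.1 l.2.2.1 l.2.2.2)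
    fun l _ => natCard_ker_eq_range_eq_mem_expPoly l.2.1 l.2.2.1 l.2.2.2
  convert! hmem using 1
  ext s
  rw [key, Nat.cast_sum, Finset.sum_apply]

end Factor

/-! ### Modified types of endomorphisms -/

section EndModType

universe u

variable {F : Type u} [Field F]

/-- The modified type of an endomorphism `a` of `V`: the elementary divisors of `(t - 1) V`, where
`t` acts by `a`. -/
def EndModType {V : Type*} [AddCommGroup V] [Module F V] (a : Module.End F V) (μ : MultiPtn F) :
    Prop := HasElemDiv (reduced F (Module.AEval' a)) μ

variable {V V' E : Type*} [AddCommGroup V] [Module F V] [AddCommGroup V'] [Module F V']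
  [AddCommGroup E] [Module F E]

theorem X_sub_one_smul_of (a : Module.End F V) (w : V) :
    (X - C 1 : F[X]) • Module.AEval'.of a w = Module.AEval'.of a (a w - w) := by
  rw [sub_smul, Module.AEval'.X_smul_of, map_one, one_smul, map_sub]

theorem mem_reduced_iff (a : Module.End F V) (w : V) :
    Module.AEval'.of a w ∈ reduced F (Module.AEval' a) ↔ w ∈ LinearMap.range (a - 1) := by
  rw [mem_smulRange]
  constructor
  · rintro ⟨y, hy⟩
    obtain ⟨y, rfl⟩ := (Module.AEval'.of a).surjective y
    rw [X_sub_one_smul_of] at hy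
    exact ⟨y, (Module.AEval'.of a).injective hy⟩
  · rintro ⟨y, rfl⟩
    exact ⟨Module.AEval'.of a y, X_sub_one_smul_of a y⟩

theorem exists_hasElemDiv_aeval [Module.Finite F V] {a : Module.End F V}
    (ha : Function.Injective a) : ∃ μ : MultiPtn F, HasElemDiv (Module.AEval' a) μ := by
  have : Module.Finite F[X] (Module.AEval' a) := inferInstance
  refine exists_hasElemDiv (Module.AEval.isTorsion_of_finiteDimensional F V a) fun x y h => ?_
  obtain ⟨x, rfl⟩ := (Module.AEval'.of a).surjective x
  obtain ⟨y, rfl⟩ := (Module.AEval'.of a).surjective y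
  simp only [Module.AEval'.X_smul_of] at h
  rw [ha ((Module.AEval'.of a).injective h)]

theorem toLin'_injective {m : ℕ} (g : GL (Fin m) F) :
    Function.Injective (Matrix.toLin' (g : Matrix (Fin m) (Fin m) F)) := by
  refine Function.LeftInverse.injective (g := Matrix.toLin' (g⁻¹ : GL (Fin m) F).1) fun x => ?_
  rw [← LinearMap.comp_apply, ← Matrix.toLin'_mul, ← Units.val_mul]
  simp

/-- Conversely, an invertible matrix has some type, and uniqueness of elementary divisors identifies
its modification with ν. -/
theorem hasModifiedType_iff [Finite F] {m : ℕ} (g : GL (Fin m) F) (ν : MultiPtn F) :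
    HasModifiedType g ν ↔ EndModType (Matrix.toLin' (g : Matrix (Fin m) (Fin m) F)) ν := by
  constructor
  · rintro ⟨μ, h, rfl⟩
    exact HasElemDiv.reduced h
  · intro h
    obtain ⟨μ, hμ⟩ := exists_hasElemDiv_aeval (toLin'_injective g)
    exact ⟨μ, hμ, hμ.reduced.unique h⟩

theorem HasModifiedType.unique [Finite F] {m : ℕ} {g : GL (Fin m) F} {ν ν' : MultiPtn F}
    (h : HasModifiedType g ν) (h' : HasModifiedType g ν') : ν = ν' :=
  HasElemDiv.unique ((hasModifiedType_iff g ν).1 h) ((hasModifiedType_iff g ν').1 h')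

theorem exists_hasModifiedType {m : ℕ} (g : GL (Fin m) F) : ∃ ν, HasModifiedType g ν := by
  obtain ⟨μ, hμ⟩ := exists_hasElemDiv_aeval (toLin'_injective g)
  exact ⟨_, μ, hμ, rfl⟩

/-- The modified type of `1 + u v` is the type of `1 + v u`. -/
theorem endModType_one_add_comp_iff {u : E →ₗ[F] V} {v : V →ₗ[F] E} (hu : Function.Injective u)
    (hv : Function.Surjective v) (μ : MultiPtn F) :
    EndModType (1 + u ∘ₗ v : Module.End F V) μ ↔
      HasElemDiv (Module.AEval' (1 + v ∘ₗ u : Module.End F E)) μ := by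
  let a : Module.End F V := 1 + u ∘ₗ v
  -- From (1 + uv)u = u(1 + vu), the map u is `F[t]`-linear; as v is surjective, its image is the
  -- range of uv = a - 1.
  let ψ : Module.AEval' (1 + v ∘ₗ u : Module.End F E) →ₗ[F[X]] Module.AEval' a :=
    LinearMap.ofAEval _ ((Module.AEval'.of a).toLinearMap ∘ₗ u) fun w => by
      rw [LinearMap.comp_apply, LinearMap.comp_apply, LinearEquiv.coe_coe,
        Module.AEval'.X_smul_of]
      congr 1
      simp [a, Module.End.smul_def]
  have hψ (w : E) : ψ (Module.AEval'.of _ w) = Module.AEval'.of a (u w) := rfl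
  have hinj : Function.Injective ψ := fun x y h => by
    obtain ⟨x, rfl⟩ := (Module.AEval'.of _).surjective x
    obtain ⟨y, rfl⟩ := (Module.AEval'.of _).surjective y
    rw [hψ, hψ] at h
    rw [hu ((Module.AEval'.of a).injective h)]
  have hrange : LinearMap.range ψ = reduced F (Module.AEval' a) := by
    ext x
    obtain ⟨x, rfl⟩ := (Module.AEval'.of a).surjective x
    rw [mem_reduced_iff]
    constructor
    · rintro ⟨y, hy⟩
      obtain ⟨y, rfl⟩ := (Module.AEval'.of _).surjective y
      obtain ⟨w, rfl⟩ := hv y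
      rw [hψ] at hy
      exact ⟨w, by rw [← (Module.AEval'.of a).injective hy]; simp [a]⟩
    · rintro ⟨w, rfl⟩
      exact ⟨Module.AEval'.of _ (v w), by rw [hψ]; congr 1; simp [a]⟩
  let e := (LinearEquiv.ofInjective ψ hinj).trans (LinearEquiv.ofEq _ _ hrange)
  exact ⟨fun h => h.congr e.symm, fun h => h.congr e⟩

/-- An equivalence intertwining two endomorphisms. -/
def aevalEquiv {a : Module.End F V} {a' : Module.End F V'} (θ : V ≃ₗ[F] V')
    (h : ∀ w, θ (a w) = a' (θ w)) : Module.AEval' a ≃ₗ[F[X]] Module.AEval' a' :=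
  LinearEquiv.ofAEval _ (θ.trans (Module.AEval'.of a')) fun w => by
    rw [LinearEquiv.trans_apply, LinearEquiv.trans_apply, Module.AEval'.X_smul_of, ← h]
    rfl

theorem EndModType.congr {a : Module.End F V} {a' : Module.End F V'} (θ : V ≃ₗ[F] V')
    (h : ∀ w, θ (a w) = a' (θ w)) {μ : MultiPtn F} (ha : EndModType a μ) : EndModType a' μ :=
  HasElemDiv.congr ha (smulRangeEquiv _ (aevalEquiv θ h))

theorem exists_intertwining {a : Module.End F V} {a' : Module.End F V'}
    (f : Module.AEval' a ≃ₗ[F[X]] Module.AEval' a') :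
    ∃ θ : V ≃ₗ[F] V', ∀ w, θ (a w) = a' (θ w) := by
  refine ⟨(Module.AEval'.of a).trans ((f.restrictScalars F).trans (Module.AEval'.of a').symm),
    fun w => ?_⟩
  apply (Module.AEval'.of a').injective
  simp only [LinearEquiv.trans_apply, LinearEquiv.apply_symm_apply, LinearEquiv.restrictScalars_apply]
  rw [← Module.AEval'.X_smul_of, ← Module.AEval'.X_smul_of, map_smul, LinearEquiv.apply_symm_apply]

/-- Adding a trivial summand does not change the modified type. -/
theorem EndModType.prodMap_id {a : Module.End F V} {μ : MultiPtn F} (h : EndModType a μ)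
    (T : Type*) [AddCommGroup T] [Module F T] :
    EndModType (a.prodMap LinearMap.id : Module.End F (V × T)) μ := by
  let b : Module.End F (V × T) := a.prodMap LinearMap.id
  let ψ : Module.AEval' a →ₗ[F[X]] Module.AEval' b :=
    LinearMap.ofAEval _ ((Module.AEval'.of b).toLinearMap ∘ₗ LinearMap.inl F V T) fun w => by
      rw [LinearMap.comp_apply, LinearMap.comp_apply, LinearEquiv.coe_coe,
        Module.AEval'.X_smul_of]
      congr 1
  have hψ (w : V) : ψ (Module.AEval'.of _ w) = Module.AEval'.of b (w, 0) := rfl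
  have hinj : Function.Injective ψ := fun x y h => by
    obtain ⟨x, rfl⟩ := (Module.AEval'.of _).surjective x
    obtain ⟨y, rfl⟩ := (Module.AEval'.of _).surjective y
    rw [hψ, hψ] at h
    exact congrArg (Module.AEval'.of a)
      (congrArg Prod.fst ((Module.AEval'.of b).injective h) :)
  have hmap : (StableCentre.reduced F (Module.AEval' a)).map ψ =
      StableCentre.reduced F (Module.AEval' b) := by
    ext x
    obtain ⟨x, rfl⟩ := (Module.AEval'.of b).surjective x
    rw [mem_reduced_iff, Submodule.mem_map]
    constructor
    · rintro ⟨y, hy, hyx⟩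
      obtain ⟨y, rfl⟩ := (Module.AEval'.of _).surjective y
      rw [hψ] at hyx
      obtain ⟨w, rfl⟩ := (mem_reduced_iff a y).1 hy
      exact ⟨(w, 0), by rw [← (Module.AEval'.of b).injective hyx]; simp [b]⟩
    · rintro ⟨⟨w, t⟩, rfl⟩
      exact ⟨Module.AEval'.of a (a w - w), (mem_reduced_iff a _).2 ⟨w, rfl⟩, by
        rw [hψ]; congr 1; simp [b]⟩
  exact HasElemDiv.congr h
    ((Submodule.equivMapOfInjective ψ hinj _).trans (LinearEquiv.ofEq _ _ hmap))

/-- The modified type determines the rank of `a - 1`. -/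
theorem exists_finrank_of_endModType [Finite F] (μ : MultiPtn F) :
    ∃ i : ℕ, ∀ (V : Type u) [AddCommGroup V] [Module F V] [Module.Finite F V] (a : Module.End F V),
      EndModType a μ → Module.finrank F (LinearMap.range (a - 1)) = i := by
  -- A model module with elementary divisors μ has the size of the range of a - 1, so the rank is a
  -- logarithm. Without a model no a has modified type μ, and 0 is arbitrary.
  by_cases hμ : ∃ (k : ℕ) (p : Fin k → Phi F) (e : Fin k → ℕ),
      ∀ (r : Phi F) (i : ℕ+), Multiset.count i (μ r) = mult p e r i
  · obtain ⟨k, p, e, hc⟩ := hμ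
    have := finite_primaryProd p e
    have hp : HasElemDiv (PrimaryProd p e) μ := hasElemDiv_of_primaryProd hc (.refl _ _)
    refine ⟨Nat.log (Nat.card F) (Nat.card (PrimaryProd p e)), fun V _ _ _ a ha => ?_⟩
    obtain ⟨f⟩ := hp.nonempty_equiv ha
    have h1 : Nat.card (reduced F (Module.AEval' a)) = Nat.card (LinearMap.range (a - 1)) :=
      (Nat.card_congr ((Module.AEval'.of a).toEquiv.subtypeEquiv fun w =>
        (mem_reduced_iff a w).symm)).symm
    rw [Nat.card_congr f.toEquiv, h1,
      Module.natCard_eq_pow_finrank (K := F) (V := LinearMap.range (a - 1)), Nat.log_pow Finite.one_lt_card]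
  · refine ⟨0, fun V _ _ _ a ha => (hμ ?_).elim⟩
    obtain ⟨k, p, e, hc, -⟩ := HasElemDiv.exists_primaryProd ha
    exact ⟨k, p, e, hc⟩

/-! ### The structure constants -/

/-- The number of pairs `(a, b)` with `a b = g`, where `a` and `b` have given modified types. -/
def pairCount (μ ν : MultiPtn F) (g : Module.End F V) : ℕ :=
  Nat.card {ab : Module.End F V × Module.End F V //
    ab.1 * ab.2 = g ∧ EndModType ab.1 μ ∧ EndModType ab.2 ν}

theorem pairCount_congr (μ ν : MultiPtn F) {g : Module.End F V} {g' : Module.End F V'}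
    (θ : V ≃ₗ[F] V') (h : ∀ w, θ (g w) = g' (θ w)) : pairCount μ ν g = pairCount μ ν g' := by
  have hg : θ.conj g = g' := by
    ext w
    rw [LinearEquiv.conj_apply_apply, h, LinearEquiv.apply_symm_apply]
  have hiff (a : Module.End F V) (μ : MultiPtn F) : EndModType a μ ↔ EndModType (θ.conj a) μ :=
    ⟨fun h => h.congr θ fun w => by simp [LinearEquiv.conj_apply_apply],
      fun h => h.congr θ.symm fun w => by simp [LinearEquiv.conj_apply_apply]⟩
  refine Nat.card_congr ((θ.conj.toEquiv.prodCongr θ.conj.toEquiv).subtypeEquiv fun ab => ?_)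
  refine and_congr ?_ (and_congr (hiff _ _) (hiff _ _))
  change _ ↔ θ.conj ab.1 * θ.conj ab.2 = g'
  have hm : θ.conj ab.1 * θ.conj ab.2 = θ.conj (ab.1 * ab.2) := (LinearEquiv.conj_comp θ _ _).symm
  rw [hm, ← hg, EmbeddingLike.apply_eq_iff_eq]

/-- The ranks i and j depend only on μ and ν, so the number of factorisations is `pairCount` times
|GL_i| |GL_j|, a nonzero constant in s that can be divided out. -/
theorem pairCount_mem_expPoly [Finite F] {V₀ : Type u} [AddCommGroup V₀] [Module F V₀]
    [Module.Finite F V₀] (μ ν : MultiPtn F) (g₀ : Module.End F V₀) :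
    (fun s : ℕ => (pairCount μ ν
      (g₀.prodMap LinearMap.id : Module.End F (V₀ × (Fin s → F))) : ℚ)) ∈ expPoly (Nat.card F) := by
  obtain ⟨i, hi⟩ := exists_finrank_of_endModType μ
  obtain ⟨j, hj⟩ := exists_finrank_of_endModType ν
  let P (k : ℕ) (μ : MultiPtn F) (Y : Module.End F (Fin k → F)) : Prop :=
    HasElemDiv (Module.AEval' (1 + Y)) μ
  have hmem := natCard_isGoodQuad_mem_expPoly (P i μ) (P j ν) g₀
  have key (s : ℕ) := natCard_isGoodQuad (V := V₀ × (Fin s → F)) (P i μ) (P j ν)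
    (fun a => EndModType a μ) (fun a => EndModType a ν)
    (fun u v hu hv => endModType_one_add_comp_iff hu hv μ)
    (fun u v hu hv => endModType_one_add_comp_iff hu hv ν)
    (fun a ha => by rw [hi _ a ha, Module.finrank_fin_fun])
    (fun a ha => by rw [hj _ a ha, Module.finrank_fin_fun])
    (g₀.prodMap LinearMap.id)
  have hfin (k : ℕ) : Finite ((Fin k → F) ≃ₗ[F] (Fin k → F)) :=
    have : Finite ((Fin k → F) →ₗ[F] (Fin k → F)) := finite_linearMap
    Finite.of_injective (fun P => P.toLinearMap) LinearEquiv.toLinearMap_injective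
  have := hfin i
  have := hfin j
  have hK : ((Nat.card ((Fin i → F) ≃ₗ[F] (Fin i → F)) *
      Nat.card ((Fin j → F) ≃ₗ[F] (Fin j → F)) : ℕ) : ℚ) ≠ 0 :=
    Nat.cast_ne_zero.2 (mul_ne_zero Nat.card_pos.ne' Nat.card_pos.ne')
  convert! Subalgebra.mul_mem _ hmem (Subalgebra.algebraMap_mem (expPoly (Nat.card F))
    ((Nat.card ((Fin i → F) ≃ₗ[F] (Fin i → F)) *
      Nat.card ((Fin j → F) ≃ₗ[F] (Fin j → F)) : ℕ) : ℚ)⁻¹) using 1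
  ext s
  rw [Pi.mul_apply, key, Nat.cast_mul]
  exact (mul_inv_cancel_right₀ hK _).symm

/-- Endomorphisms of the same modified type are conjugate, after adding a trivial summand. -/
theorem exists_intertwining_of_endModType [Finite F] {m₀ s : ℕ} {a₀ : Module.End F (Fin m₀ → F)}
    {a : Module.End F (Fin (m₀ + s) → F)} (ha₀ : Function.Injective a₀)
    (ha : Function.Injective a) {lam : MultiPtn F} (h₀ : EndModType a₀ lam)
    (h : EndModType a lam) : ∃ θ : (Fin (m₀ + s) → F) ≃ₗ[F] (Fin m₀ → F) × (Fin s → F),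
      ∀ w, θ (a w) = (a₀.prodMap LinearMap.id : Module.End F _) (θ w) := by
  let b : Module.End F ((Fin m₀ → F) × (Fin s → F)) := a₀.prodMap LinearMap.id
  have hb : Function.Injective b := ha₀.prodMap Function.injective_id
  obtain ⟨μ, hμ⟩ := exists_hasElemDiv_aeval ha
  obtain ⟨μ', hμ'⟩ := exists_hasElemDiv_aeval hb
  obtain ⟨f⟩ := HasElemDiv.nonempty_equiv h (h₀.prodMap_id (Fin s → F))
  have hcard : Nat.card (Module.AEval' a) = Nat.card (Module.AEval' b) := by
    rw [← Nat.card_congr (Module.AEval'.of a).toEquiv, ← Nat.card_congr (Module.AEval'.of b).toEquiv,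
      Module.natCard_eq_pow_finrank (K := F),
      Module.natCard_eq_pow_finrank (K := F) (V := (Fin m₀ → F) × (Fin s → F)),
      Module.finrank_prod, Module.finrank_fin_fun, Module.finrank_fin_fun, Module.finrank_fin_fun]
  obtain ⟨f'⟩ := hμ.nonempty_equiv_of_reduced hμ' f hcard
  exact exists_intertwining f'

/-- The structure constants are values of a quantum integer-valued polynomial. -/
theorem exists_structure_polynomial [Fintype F] (μ ν lam : MultiPtn F) :
    ∃ f : quantumIntValued,
      (∀ (m : ℕ) (g : GL (Fin m) F), HasModifiedType g lam → valueAt (Fintype.card F) f m =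
        pairCount μ ν (Matrix.toLin' (g : Matrix (Fin m) (Fin m) F))) ∧
      (∃ P : ℚ[X], ∀ m : ℤ, valueAt (Fintype.card F) f m = P.eval ((Fintype.card F : ℚ) ^ m)) ∧
      ((∀ (m : ℕ) (g : GL (Fin m) F), HasModifiedType g lam →
        pairCount μ ν (Matrix.toLin' (g : Matrix (Fin m) (Fin m) F)) = 0) → f = 0) := by
  classical
  have hq : 1 < Fintype.card F := Fintype.one_lt_card
  have h0 : ((Fintype.card F : ℕ) : ℚ) ≠ 0 := by positivity
  have hzero (m : ℤ) : valueAt (Fintype.card F) 0 m = 0 := by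
    rw [← valueHom_apply _ h0, map_zero]
  -- Choosing 0 whenever no product involves λ is what later gives finite support.
  by_cases H : ∀ (m : ℕ) (g : GL (Fin m) F), HasModifiedType g lam →
      pairCount μ ν (Matrix.toLin' (g : Matrix (Fin m) (Fin m) F)) = 0
  · refine ⟨0, fun m g hg => ?_, ⟨0, fun m => ?_⟩, fun _ => rfl⟩
    · rw [H m g hg, hzero, Nat.cast_zero]
    · rw [hzero, eval_zero]
  · have hex : ∃ (m : ℕ) (g : GL (Fin m) F), HasModifiedType g lam := by
      push Not at H
      obtain ⟨m, g, hg, -⟩ := H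
      exact ⟨m, g, hg⟩
    -- By minimality of the size, every g of this modified type is conjugate to g₀ ⊕ id with s ≥ 0,
    -- so one polynomial serves all m.
    obtain ⟨g₀, hg₀⟩ := Nat.find_spec hex
    have hmin (m : ℕ) (g : GL (Fin m) F) (hg : HasModifiedType g lam) : Nat.find hex ≤ m :=
      Nat.find_min' hex ⟨g, hg⟩
    generalize Nat.find hex = m₀ at g₀ hg₀ hmin
    let a₀ := Matrix.toLin' (g₀ : Matrix (Fin m₀) (Fin m₀) F)
    obtain ⟨P, hP⟩ := mem_expPoly.1 (pairCount_mem_expPoly μ ν a₀)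
    rw [Nat.card_eq_fintype_card] at hP
    obtain ⟨f, hf, hQ⟩ := exists_quantumIntValued hq m₀
      (fun s => pairCount μ ν (a₀.prodMap LinearMap.id : Module.End F ((Fin m₀ → F) × (Fin s → F))))
      P (fun s => by rw [Int.cast_natCast]; exact hP s)
    refine ⟨f, fun m g hg => ?_, hQ, fun h => (H h).elim⟩
    obtain ⟨s, rfl⟩ := Nat.exists_eq_add_of_le (hmin m g hg)
    obtain ⟨θ, hθ⟩ := exists_intertwining_of_endModType (toLin'_injective g₀) (toLin'_injective g)
      ((hasModifiedType_iff _ _).1 hg₀) ((hasModifiedType_iff _ _).1 hg)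
    rw [pairCount_congr μ ν θ hθ, Nat.cast_add, hf, Int.cast_natCast]

theorem subsingleton_setOf_hasElemDiv [Finite F] (M : Type*) [AddCommGroup M] [Module F[X] M] :
    {lam : MultiPtn F | HasElemDiv M lam}.Subsingleton := fun _ h _ h' => HasElemDiv.unique h h'

/-- For given `μ` and `ν`, only finitely many modified types occur in the products. -/
theorem finite_setOf_pairCount_ne_zero [Finite F] (μ ν : MultiPtn F) :
    {lam : MultiPtn F | ∃ (m : ℕ) (g : GL (Fin m) F), HasModifiedType g lam ∧
      pairCount μ ν (Matrix.toLin' (g : Matrix (Fin m) (Fin m) F)) ≠ 0}.Finite := by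
  obtain ⟨i, hi⟩ := exists_finrank_of_endModType μ
  obtain ⟨j, hj⟩ := exists_finrank_of_endModType ν
  have hfin (l : ℕ) : Finite (Module.End F (Fin l → F)) := finite_linearMap
  -- Each λ that occurs is the type of an endomorphism of F^l with l ≤ i + j, and there are finitely
  -- many of these.
  refine Set.Finite.subset (s := ⋃ l : Fin (i + j + 1), ⋃ Y : Module.End F (Fin l → F),
    {lam | HasElemDiv (Module.AEval' Y) lam}) (Set.finite_iUnion fun l => Set.finite_iUnion fun Y =>
      (subsingleton_setOf_hasElemDiv _).finite) ?_
  rintro lam ⟨m, g, hg, hne⟩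
  obtain ⟨⟨⟨a, b⟩, hab, ha, hb⟩⟩ := (Nat.card_ne_zero.1 hne).1
  simp only at hab ha hb
  rw [hasModifiedType_iff] at hg
  have hrank : Module.finrank F (LinearMap.range
      (Matrix.toLin' (g : Matrix (Fin m) (Fin m) F) - 1 : Module.End F (Fin m → F))) ≤ i + j := by
    have hsub : Matrix.toLin' (g : Matrix (Fin m) (Fin m) F) - 1 = (a - 1) * b + (b - 1) := by
      rw [← hab, sub_mul, one_mul]; abel
    have hle : LinearMap.range ((a - 1) * b + (b - 1)) ≤
        LinearMap.range (a - 1) ⊔ LinearMap.range (b - 1) := by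
      rintro _ ⟨w, rfl⟩
      exact Submodule.add_mem_sup ⟨b w, rfl⟩ ⟨w, rfl⟩
    rw [hsub, ← hi _ a ha, ← hj _ b hb]
    exact (Submodule.finrank_mono hle).trans (Submodule.finrank_add_le_finrank_add_finrank _ _)
  obtain ⟨u, v, hu, hv, huv⟩ := exists_factorization (E := Fin (Module.finrank F (LinearMap.range
      (Matrix.toLin' (g : Matrix (Fin m) (Fin m) F) - 1 : Module.End F (Fin m → F)))) → F)
      (Matrix.toLin' (g : Matrix (Fin m) (Fin m) F) - 1 : Module.End F (Fin m → F))
      (by rw [Module.finrank_fin_fun])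
  -- With g = 1 + uv through F^l, where l = rank(g - 1), the modified type of g is the type of 1 +
  -- vu on F^l.
  rw [← add_sub_cancel (1 : Module.End F (Fin m → F))
    (Matrix.toLin' (g : Matrix (Fin m) (Fin m) F)), ← huv, endModType_one_add_comp_iff hu hv] at hg
  exact Set.mem_iUnion.2 ⟨⟨_, Nat.lt_succ_of_le hrank⟩, Set.mem_iUnion.2 ⟨_, hg⟩⟩

end EndModType

/-! ### The product formula -/

section Product

variable {F : Type*} [Field F]

/-- Pairs of invertible matrices correspond to pairs of endomorphisms. -/
theorem natCard_units_pairs [Finite F] {m : ℕ} (μ ν : MultiPtn F) (g : GL (Fin m) F) :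
    Nat.card {ab : GL (Fin m) F × GL (Fin m) F //
      ab.1 * ab.2 = g ∧ HasModifiedType ab.1 μ ∧ HasModifiedType ab.2 ν} =
    pairCount μ ν (Matrix.toLin' (g : Matrix (Fin m) (Fin m) F)) := by
  let φ (a : GL (Fin m) F) : Module.End F (Fin m → F) := Matrix.toLin' a.1
  have hφ : Function.Injective φ := fun a b h => Units.ext (Matrix.toLin'.injective h)
  refine Nat.card_congr (Equiv.ofBijective (fun ab => ⟨(φ ab.1.1, φ ab.1.2), ?_⟩) ⟨?_, ?_⟩)
  · refine ⟨?_, (hasModifiedType_iff _ _).1 ab.2.2.1, (hasModifiedType_iff _ _).1 ab.2.2.2⟩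
    refine Eq.trans ?_ (congrArg φ ab.2.1)
    exact (Matrix.toLin'_mul _ _).symm
  · intro x y h
    have h' := congrArg Subtype.val h
    exact Subtype.ext (Prod.ext (hφ (congrArg Prod.fst h')) (hφ (congrArg Prod.snd h')))
  · rintro ⟨⟨α, β⟩, hαβ, hα, hβ⟩
    have hmul : LinearMap.toMatrix' α * LinearMap.toMatrix' β = g.1 := by
      rw [← LinearMap.toMatrix'_mul, hαβ, LinearMap.toMatrix'_toLin']
    -- `pairCount` ranges over all endomorphisms, but αβ = g is invertible, so the square matrices α
    -- and β have one-sided, hence two-sided, inverses.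
    have h1 : LinearMap.toMatrix' α * (LinearMap.toMatrix' β * (g⁻¹ : GL (Fin m) F).1) = 1 := by
      rw [← mul_assoc, hmul, ← Units.val_mul, mul_inv_cancel, Units.val_one]
    have h2 : ((g⁻¹ : GL (Fin m) F).1 * LinearMap.toMatrix' α) * LinearMap.toMatrix' β = 1 := by
      rw [mul_assoc, hmul, ← Units.val_mul, inv_mul_cancel, Units.val_one]
    let a : GL (Fin m) F := ⟨_, _, h1, mul_eq_one_comm.1 h1⟩
    let b : GL (Fin m) F := ⟨_, _, mul_eq_one_comm.1 h2, h2⟩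
    have ha : φ a = α := Matrix.toLin'_toMatrix' α
    have hb : φ b = β := Matrix.toLin'_toMatrix' β
    rw [← ha] at hα
    rw [← hb] at hβ
    exact ⟨⟨(a, b), Units.ext hmul, (hasModifiedType_iff a μ).2 hα, (hasModifiedType_iff b ν).2 hβ⟩,
      Subtype.ext (Prod.ext ha hb)⟩

theorem exists_of_XSum_ne_zero [Fintype F] {m : ℕ} {lam : MultiPtn F}
    (h : (XSum lam m : Subring.center (MonoidAlgebra ℤ (GL (Fin m) F))) ≠ 0) :
    ∃ g : GL (Fin m) F, HasModifiedType g lam := by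
  classical
  by_contra hne
  push Not at hne
  refine h (Subtype.ext ?_)
  change modifiedTypeSum lam m = 0
  rw [modifiedTypeSum, Finset.filter_false_of_mem fun g _ => hne g, Finset.sum_empty]

open Classical in
theorem toRat_XSum [Fintype F] (lam : MultiPtn F) (m : ℕ) :
    toRat (XSum lam m) = ∑ g : GL (Fin m) F with HasModifiedType g lam,
      MonoidAlgebra.of ℚ (GL (Fin m) F) g := by
  change MonoidAlgebra.mapRingHom (GL (Fin m) F) (Int.castRingHom ℚ) (modifiedTypeSum lam m) = _
  rw [modifiedTypeSum, map_sum]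
  refine Finset.sum_congr rfl fun g _ => ?_
  simp

open Classical in
theorem toRat_XSum_mul [Fintype F] (μ ν : MultiPtn F) (m : ℕ) :
    toRat (XSum μ m * XSum ν m) = ∑ g : GL (Fin m) F,
      (pairCount μ ν (Matrix.toLin' (g : Matrix (Fin m) (Fin m) F)) : ℚ) •
        MonoidAlgebra.of ℚ (GL (Fin m) F) g := by
  rw [map_mul, toRat_XSum, toRat_XSum, Finset.sum_mul_sum, ← Finset.sum_product',
    ← Finset.sum_fiberwise (g := fun ab : GL (Fin m) F × GL (Fin m) F => ab.1 * ab.2)]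
  refine Finset.sum_congr rfl fun g _ => ?_
  have hcard : pairCount μ ν (Matrix.toLin' (g : Matrix (Fin m) (Fin m) F)) =
      (((Finset.univ.filter fun a : GL (Fin m) F => HasModifiedType a μ) ×ˢ
        (Finset.univ.filter fun b : GL (Fin m) F => HasModifiedType b ν)).filter
          fun ab => ab.1 * ab.2 = g).card := by
    rw [← natCard_units_pairs, Nat.card_eq_fintype_card, Fintype.card_subtype]
    congr 1
    ext ab
    simp only [Finset.mem_filter, Finset.mem_univ, Finset.mem_product, true_and]
    tauto
  rw [hcard, Nat.cast_smul_eq_nsmul, ← Finset.sum_const]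
  refine Finset.sum_congr rfl fun ab hab => ?_
  rw [← map_mul, (Finset.mem_filter.1 hab).2]

end Product

end StableCentre

end

open StableCentre in
theorem theorem6p1 {F : Type*} [Field F] [Fintype F] :
    ∃ r : MultiPtn F → MultiPtn F → (MultiPtn F →₀ quantumIntValued),
      -- the product formula, for every `m`
      (∀ (m : ℕ) (μ ν : MultiPtn F),
        toRat (XSum μ m * XSum ν m) =
          (r μ ν).sum fun lam f => valueAt (Fintype.card F) f m • toRat (XSum lam m)) ∧
      -- the coefficients of the nonzero `X_{λ,m}` are integers
      (∀ (m : ℕ) (μ ν lam : MultiPtn F), XSum lam m ≠ 0 →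
        ∃ a : ℤ, valueAt (Fintype.card F) (r μ ν lam) m = a) ∧
      -- the coefficients are polynomials in `q ^ m`
      (∀ μ ν lam : MultiPtn F, ∃ P : ℚ[X], ∀ m : ℤ,
        valueAt (Fintype.card F) (r μ ν lam) m = P.eval ((Fintype.card F : ℚ) ^ m)) := by
  classical
  choose f hval hpoly hzero using fun μ ν lam : MultiPtn F => exists_structure_polynomial μ ν lam
  have hsupp (μ ν : MultiPtn F) : (Function.support (f μ ν)).Finite :=
    (finite_setOf_pairCount_ne_zero μ ν).subset fun lam hlam => by
      by_contra h
      refine hlam (hzero μ ν lam fun m g hg => ?_)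
      by_contra hne
      exact h ⟨m, g, hg, hne⟩
  refine ⟨fun μ ν => Finsupp.ofSupportFinite (f μ ν) (hsupp μ ν), fun m μ ν => ?_,
    fun m μ ν lam h => ?_, fun μ ν lam => hpoly μ ν lam⟩
  · have h0 : ((Fintype.card F : ℕ) : ℚ) ≠ 0 := Nat.cast_ne_zero.2 Fintype.card_ne_zero
    rw [toRat_XSum_mul, Finsupp.sum]
    simp only [toRat_XSum, Finset.smul_sum, Finset.sum_filter]
    rw [Finset.sum_comm]
    refine Finset.sum_congr rfl fun g _ => ?_
    -- Each g has exactly one modified type, so in the coefficient of g the sum over λ collapses to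
    -- one term.
    obtain ⟨lam, hlam⟩ := exists_hasModifiedType g
    rw [Finset.sum_eq_single lam, if_pos hlam]
    · rw [← hval μ ν lam m g hlam]
      rfl
    · intro lam' _ hne
      rw [if_neg fun h => hne (h.unique hlam), smul_zero]
    · intro hns
      rw [Finsupp.notMem_support_iff.1 hns, ← valueHom_apply _ h0, map_zero, zero_smul]
  · obtain ⟨g, hg⟩ := exists_of_XSum_ne_zero h
    exact ⟨_, (hval μ ν lam m g hg).trans (Int.cast_natCast _).symm⟩
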